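/- All groups are finite. Let $\pi$ be a set of primes and $\pi'$ the set of primes not in $\pi$. A group $G$ is $\pi$-soluble if it has a series $1=G_0\lhd G_1\lhd\cdots\lhd G_m=G$ each of whose factors $G_i/G_{i-1}$ is either a $p$-group for some $p\in\pi$ or a $\pi'$-group. A group is $p$-nilpotent if it has a normal Hall $p'$-subgroup, and $\pi$-nilpotent if it is $p$-nilpotent for every $p\in\pi$; $\mathfrak{N}^{\pi}$ denotes the class of all $\pi$-nilpotent groups. A Fitting class is an isomorphism-closed class of groups that is closed under taking normal subgroups and under products of normal subgroups belonging to the class. For a non-empty Fitting class $\mathfrak{X}$, the $\mathfrak{X}$-radical $G_{\mathfrak{X}}$ of $G$ is the unique maximal normal subgroup of $G$ that belongs to $\mathfrak{X}$, and $\mathfrak{X}\mathfrak{N}^{\pi}$ is the class of all groups $G$ with $G/G_{\mathfrak{X}}\in\mathfrak{N}^{\pi}$. For a class $\mathfrak{F}$ of groups, a subgroup $V$ of $G$ is $\mathfrak{F}$-maximal in $G$ if $V\in\mathfrak{F}$ and $U=V$ whenever $V\le U\le G$ and $U\in\mathfrak{F}$; it is an $\mathfrak{F}$-injector of $G$ if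 $V\cap K$ is an $\mathfrak{F}$-maximal subgroup of $K$ for every subnormal subgroup $K$ of $G$. **Corollary.** Let $\pi$ be any set of primes and let $\mathfrak{X}$ be any non-empty Fitting class. Then every $\pi$-soluble group $G$ possesses exactly one conjugacy class of $\mathfrak{X}\mathfrak{N}^{\pi}$-injectors; that is, $G$ has an $\mathfrak{X}\mathfrak{N}^{\pi}$-injector, and the set of all $\mathfrak{X}\mathfrak{N}^{\pi}$-injectors of $G$ is a single conjugacy class of subgroups of $G$. -/

import Mathlib

universe u

/-- A class of groups, given by its membership predicate. -/
abbrev GroupClass : Type (u + 1) := ∀ (G : Type u) [Group G], Prop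

namespace GroupClass

/-- A class of groups is non-empty if some group belongs to it. -/
def IsNonempty (F : GroupClass.{u}) : Prop :=
  ∃ (G : Type u) (_ : Group G), F G

/-- A Fitting class (of finite groups): an isomorphism-closed class of finite groups that is closed
under taking normal subgroups and under products of normal subgroups belonging to the class. -/
structure IsFitting (F : GroupClass.{u}) : Prop where
  finite : ∀ (G : Type u) [Group G], F G → Finite G
  iso : ∀ (G H : Type u) [Group G] [Group H], Nonempty (G ≃* H) → F G → F H
  normal : ∀ (G : Type u) [Group G] (N : Subgroup G), N.Normal → F G → F N
  sup : ∀ (G : Type u) [Group G] [Finite G] (M N : Subgroup G), M.Normal → N.Normal →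
    F M → F N → F (M ⊔ N : Subgroup G)

/-- The `F`-radical of `G`: the subgroup generated by all normal subgroups of `G` that belong to
`F`. When `F` is a non-empty Fitting class and `G` is finite, this is the unique maximal normal
`F`-subgroup of `G`. -/
def radical (F : GroupClass.{u}) (G : Type u) [Group G] : Subgroup G :=
  sSup {N : Subgroup G | N.Normal ∧ F N}

instance radical_normal (F : GroupClass.{u}) (G : Type u) [Group G] :
    (F.radical G).Normal :=
  Subgroup.sSup_normal _ fun _ hN => hN.1

/-- The product `F H` of two classes: the finite groups `G` such that `G / G_F` belongs to `H`. -/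
def prod (F H : GroupClass.{u}) : GroupClass.{u} := fun G _ =>
  Finite G ∧ H (G ⧸ F.radical G)

/-- `V` is an `F`-maximal subgroup of `G`. -/
def IsMaximalSubgroup (F : GroupClass.{u}) {G : Type u} [Group G] (V : Subgroup G) : Prop :=
  F V ∧ ∀ U : Subgroup G, V ≤ U → F U → U = V

/-- `V` is an `F`-injector of `G`: for every subnormal subgroup `K` of `G`, the intersection
`V ∩ K`, as a subgroup of `K`, is `F`-maximal in `K`. -/
def IsInjector (F : GroupClass.{u}) {G : Type u} [Group G] (V : Subgroup G) : Prop :=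
  ∀ K : Subgroup G, K.IsSubnormal → F.IsMaximalSubgroup (V.subgroupOf K)

end GroupClass

/-- A (finite) `π`-group: every prime dividing its order lies in `π`. -/
def IsPiGroup (π : Set Nat.Primes) (G : Type u) [Group G] : Prop :=
  Finite G ∧ ∀ p : Nat.Primes, (p : ℕ) ∣ Nat.card G → p ∈ π

/-- `H` is a Hall `π`-subgroup of the finite group `G`: it is a `π`-group, and every prime dividing
its index lies in the complement of `π`. -/
def IsHallSubgroup (π : Set Nat.Primes) {G : Type u} [Group G] (H : Subgroup G) : Prop :=
  IsPiGroup π H ∧ ∀ p : Nat.Primes, (p : ℕ) ∣ H.index → p ∈ πᶜ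

/-- A finite group is `p`-nilpotent if it has a normal Hall `p'`-subgroup. -/
def IsPNilpotent (p : Nat.Primes) (G : Type u) [Group G] : Prop :=
  ∃ N : Subgroup G, N.Normal ∧ IsHallSubgroup ({p}ᶜ) N

/-- The class of (finite) `π`-nilpotent groups: those that are `p`-nilpotent for all `p ∈ π`. -/
def piNilpotent (π : Set Nat.Primes) : GroupClass.{u} := fun G _ =>
  Finite G ∧ ∀ p ∈ π, IsPNilpotent p G

/-- A finite group is `π`-soluble if it has a series `1 = G₀ ⊴ G₁ ⊴ ⋯ ⊴ Gₘ = G` each of whose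
factors is either a `p`-group for some `p ∈ π` or a `π'`-group. -/
def IsPiSoluble (π : Set Nat.Primes) (G : Type u) [Group G] : Prop :=
  Finite G ∧ ∃ (m : ℕ) (S : ℕ → Subgroup G), S 0 = ⊥ ∧ S m = ⊤ ∧
    ∀ i < m, S i ≤ S (i + 1) ∧ ∃ _ : ((S i).subgroupOf (S (i + 1))).Normal,
      (∃ p ∈ π, IsPGroup (p : ℕ) (S (i + 1) ⧸ (S i).subgroupOf (S (i + 1)))) ∨
        IsPiGroup πᶜ (S (i + 1) ⧸ (S i).subgroupOf (S (i + 1)))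

/-! Let E be the class of X-by-π'-groups. Modulo the intersection of its normal p-complements (p ∈
π), a π-nilpotent group is a nilpotent π-group, and that intersection is a π'-group. Hence X N^π is
the class 𝔉 of extensions of E-groups by nilpotent π-groups (`prod_piNilpotent_eq`). Write O and T
for the E- and 𝔉-radicals of G, and H = G/O.

H has no nontrivial normal π'-subgroup and T/O is its largest normal nilpotent π-subgroup, so
π-solubility forces T/O to contain its centralizer (`HasPiSeries.centralizer_inf_le`). It follows
that the 𝔉-subgroups of G containing T are exactly the preimages of the nilpotent subgroups of H
containing T/O.

For a normal self-centralizing F in H, let C_p be the centralizer of the p'-elements of F. If V is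
nilpotent and contains F, its Sylow p-subgroup lies in C_p. For p ≠ q, [C_p, C_q] ≤ C_p ∩ C_q = C(F)
≤ F, so Sylow subgroups can be adjusted by conjugation one prime at a time without disturbing the
other primes. This makes all maximal nilpotent subgroups over F conjugate
(`exists_conj_le_isNilpotent`).

Finally, the injectors are precisely the 𝔉-maximal subgroups containing T (`isInjector_iff`): for M
normal, an 𝔉-subgroup of M containing T ∩ M generates with T a subgroup lying in an 𝔉-subgroup, and
conjugacy then bounds its order by that of V ∩ M. -/

/-- A `σ`-number: a positive integer all of whose prime divisors belong to `σ`. -/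
def IsPiNumber (σ : Set Nat.Primes) (n : ℕ) : Prop :=
  n ≠ 0 ∧ ∀ p : Nat.Primes, (p : ℕ) ∣ n → p ∈ σ

namespace IsPiNumber

variable {σ τ : Set Nat.Primes} {m n : ℕ}

theorem one (σ : Set Nat.Primes) : IsPiNumber σ 1 :=
  ⟨one_ne_zero, fun p hp => absurd (Nat.dvd_one.1 hp) p.2.one_lt.ne'⟩

theorem mul (hm : IsPiNumber σ m) (hn : IsPiNumber σ n) : IsPiNumber σ (m * n) :=
  ⟨mul_ne_zero hm.1 hn.1, fun p hp => (p.2.dvd_mul.1 hp).elim (hm.2 p) (hn.2 p)⟩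

theorem mono (hn : IsPiNumber σ n) (h : σ ⊆ τ) : IsPiNumber τ n :=
  ⟨hn.1, fun p hp => h (hn.2 p hp)⟩

theorem coprime (hm : IsPiNumber σ m) (hn : IsPiNumber τ n) (h : Disjoint σ τ) :
    m.Coprime n := by
  refine Nat.Coprime.symm (Nat.coprime_of_dvd fun p hp h1 h2 => ?_)
  exact Set.disjoint_left.1 h (hm.2 ⟨p, hp⟩ h2) (hn.2 ⟨p, hp⟩ h1)

theorem singleton_pow (p : Nat.Primes) (k : ℕ) : IsPiNumber {p} ((p : ℕ) ^ k) :=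
  ⟨pow_ne_zero _ p.2.ne_zero, fun q hq =>
    Subtype.ext ((Nat.prime_dvd_prime_iff_eq q.2 p.2).1 (q.2.dvd_of_dvd_pow hq))⟩

theorem eq_pow {p : Nat.Primes} (h : IsPiNumber {p} n) : ∃ k, n = (p : ℕ) ^ k :=
  ⟨_, Nat.eq_prime_pow_of_unique_prime_dvd h.1 fun {q} hq hd =>
    congrArg Subtype.val (h.2 ⟨q, hq⟩ hd : (⟨q, hq⟩ : Nat.Primes) = p)⟩

end IsPiNumber

theorem isPiGroup_iff_pow {σ : Set Nat.Primes} {G : Type u} [Group G] [Finite G] :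
    IsPiGroup σ G ↔ ∀ x : G, ∃ n, IsPiNumber σ n ∧ x ^ n = 1 := by
  constructor
  · rintro ⟨_, h⟩ x
    exact ⟨Nat.card G, ⟨Nat.card_pos.ne', h⟩, pow_card_eq_one'⟩
  · refine fun h => ⟨‹_›, fun p hp => ?_⟩
    have : Fact (p : ℕ).Prime := ⟨p.2⟩
    obtain ⟨x, hx⟩ := exists_prime_orderOf_dvd_card' (p : ℕ) hp
    obtain ⟨n, hn, hxn⟩ := h x
    exact hn.2 p (hx ▸ orderOf_dvd_of_pow_eq_one hxn)

theorem IsPiGroup.isPiNumber_card {σ : Set Nat.Primes} {G : Type u} [Group G]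
    (h : IsPiGroup σ G) : IsPiNumber σ (Nat.card G) := by
  have := h.1
  exact ⟨Nat.card_pos.ne', h.2⟩

/-! ### Classes closed under subgroups and quotients; σ-groups. -/

/-- A class of groups is closed under subgroups and homomorphic images. -/
structure GroupClass.IsSQClosed (H : GroupClass.{u}) : Prop where
  subgroup : ∀ (G : Type u) [Group G] (K : Subgroup G), H G → H K
  quotient : ∀ (G Q : Type u) [Group G] [Group Q] (f : G →* Q),
    Function.Surjective f → H G → H Q

namespace GroupClass

/-- `B` is a quotient of the subgroup `f.range` of `A`. Sections are handled this way throughout,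
without explicit isomorphism theorems. -/
theorem IsSQClosed.of_ker_le {H : GroupClass.{u}} (hH : H.IsSQClosed) {G A B : Type u} [Group G]
    [Group A] [Group B] (f : G →* A) (g : G →* B) (hg : Function.Surjective g)
    (h : f.ker ≤ g.ker) (hA : H A) : H B := by
  have hs := f.rangeRestrict_surjective
  have hk : f.rangeRestrict.ker ≤ g.ker := by rwa [MonoidHom.ker_rangeRestrict]
  refine hH.quotient f.range B (f.rangeRestrict.liftOfSurjective hs ⟨g, hk⟩) (fun b => ?_)
    (hH.subgroup A f.range hA)
  obtain ⟨x, rfl⟩ := hg b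
  exact ⟨f.rangeRestrict x, MonoidHom.liftOfRightInverse_comp_apply _ _ _ ⟨g, hk⟩ x⟩

theorem IsSQClosed.of_injective {H : GroupClass.{u}} (hH : H.IsSQClosed) {G A : Type u} [Group G]
    [Group A] (f : G →* A) (hf : Function.Injective f) (hA : H A) : H G :=
  hH.of_ker_le f (MonoidHom.id G) Function.surjective_id
    (by rw [(MonoidHom.ker_eq_bot_iff f).2 hf]; exact bot_le) hA

theorem isSQClosed_isPiGroup (σ : Set Nat.Primes) : IsSQClosed (IsPiGroup.{u} σ) where
  subgroup G _ K h := by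
    have := h.1
    exact ⟨inferInstance, fun p hp => h.2 p (hp.trans K.card_subgroup_dvd_card)⟩
  quotient G Q _ _ f hf h := by
    have := h.1
    exact ⟨Finite.of_surjective f hf, fun p hp => h.2 p (hp.trans (Subgroup.card_dvd_of_surjective f hf))⟩

theorem isFitting_isPiGroup (σ : Set Nat.Primes) : IsFitting (IsPiGroup.{u} σ) where
  finite G _ h := h.1
  iso G H _ _ e h := (isSQClosed_isPiGroup σ).quotient G H e.some.toMonoidHom e.some.surjective h
  normal G _ N _ h := (isSQClosed_isPiGroup σ).subgroup G N h
  sup G _ _ M N _ hN hM' hN' := by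
    rw [isPiGroup_iff_pow] at *
    rintro ⟨x, hx⟩
    obtain ⟨a, ha, b, hb, rfl⟩ := Subgroup.mem_sup_of_normal_right.1 hx
    obtain ⟨m, hm, ham⟩ := hM' ⟨a, ha⟩
    have key : (a * b) ^ m ∈ N := by
      rw [← QuotientGroup.eq_one_iff, QuotientGroup.mk_pow, QuotientGroup.mk_mul,
        (QuotientGroup.eq_one_iff b).2 hb, mul_one, ← QuotientGroup.mk_pow,
        show a ^ m = 1 from congrArg Subtype.val ham, QuotientGroup.mk_one]
    obtain ⟨n, hn, h1⟩ := hN' ⟨_, key⟩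
    exact ⟨m * n, hm.mul hn, Subtype.ext (by simpa [pow_mul] using congrArg Subtype.val h1)⟩

theorem isNonempty_isPiGroup (σ : Set Nat.Primes) : IsNonempty (IsPiGroup.{u} σ) :=
  ⟨PUnit, inferInstance, isPiGroup_iff_pow.2 fun _ => ⟨1, IsPiNumber.one σ, rfl⟩⟩

/-! ### Fitting classes and their radicals. -/

variable {X : GroupClass.{u}}

theorem IsFitting.bot (hX : X.IsFitting) (hne : X.IsNonempty) (G : Type u) [Group G] :
    X (⊥ : Subgroup G) := by
  obtain ⟨A, _, hA⟩ := hne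
  exact hX.iso (⊥ : Subgroup A) _ ⟨MulEquiv.ofUnique⟩ (hX.normal A ⊥ inferInstance hA)

theorem IsFitting.congr (hX : X.IsFitting) {G H : Type u} [Group G] [Group H] (e : G ≃* H) :
    X G ↔ X H :=
  ⟨hX.iso G H ⟨e⟩, hX.iso H G ⟨e.symm⟩⟩

theorem IsFitting.map_iff (hX : X.IsFitting) {G H : Type u} [Group G] [Group H] (K : Subgroup G)
    (f : G →* H) (hf : Function.Injective f) : X (K.map f) ↔ X K :=
  (hX.congr (K.equivMapOfInjective f hf)).symm

theorem IsFitting.subgroupOf_iff (hX : X.IsFitting) {G : Type u} [Group G] {K L : Subgroup G}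
    (h : K ≤ L) : X (K.subgroupOf L) ↔ X K :=
  hX.congr (Subgroup.subgroupOfEquivOfLe h)

theorem IsFitting.top_iff (hX : X.IsFitting) {G : Type u} [Group G] :
    X (⊤ : Subgroup G) ↔ X G :=
  hX.congr Subgroup.topEquiv

theorem IsFitting.of_normalized (hX : X.IsFitting) {G : Type u} [Group G] {K L : Subgroup G}
    (h : K ≤ L) (hn : ∀ l ∈ L, ∀ k ∈ K, l * k * l⁻¹ ∈ K) (hL : X L) : X K := by
  refine (hX.subgroupOf_iff h).1 (hX.normal L _ ⟨fun k hk l => ?_⟩ hL)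
  exact hn l l.2 k hk

theorem le_radical {G : Type u} [Group G] {N : Subgroup G} (h : N.Normal) (hN : X N) :
    N ≤ X.radical G :=
  le_sSup ⟨h, hN⟩

/-- By finiteness there is a maximal normal `X`-subgroup, and closure under normal products makes it
absorb all the others. -/
theorem IsFitting.radical_mem (hX : X.IsFitting) (hne : X.IsNonempty) (G : Type u) [Group G]
    [Finite G] : X (X.radical G) := by
  obtain ⟨N, hN⟩ := (Set.toFinite {N : Subgroup G | N.Normal ∧ X N}).exists_maximal
    ⟨⊥, inferInstance, hX.bot hne G⟩
  have : X.radical G = N := by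
    refine le_antisymm (sSup_le fun M hM => ?_) (le_radical hN.prop.1 hN.prop.2)
    have := hM.1
    have := hN.prop.1
    exact le_sup_left.trans (hN.le_of_ge (y := M ⊔ N)
      ⟨inferInstance, hX.sup G M N hM.1 hN.prop.1 hM.2 hN.prop.2⟩ le_sup_right)
  rw [this]
  exact hN.prop.2

/-- The `X`-radical of the subgroup `K`, as a subgroup of the ambient group. -/
def radicalOf (X : GroupClass.{u}) {G : Type u} [Group G] (K : Subgroup G) : Subgroup G :=
  (X.radical K).map K.subtype

theorem radicalOf_le {G : Type u} [Group G] (K : Subgroup G) : X.radicalOf K ≤ K :=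
  Subgroup.map_subtype_le _

theorem IsFitting.radicalOf_mem (hX : X.IsFitting) (hne : X.IsNonempty) {G : Type u} [Group G]
    [Finite G] (K : Subgroup G) : X (X.radicalOf K) :=
  (hX.map_iff _ _ K.subtype_injective).2 (hX.radical_mem hne K)

theorem conj_mem_radicalOf {G : Type u} [Group G] {K : Subgroup G} {k x : G} (hk : k ∈ K)
    (hx : x ∈ X.radicalOf K) : k * x * k⁻¹ ∈ X.radicalOf K := by
  obtain ⟨y, hy, rfl⟩ := hx
  exact ⟨⟨k, hk⟩ * y * ⟨k, hk⟩⁻¹, (X.radical_normal K).conj_mem y hy _, rfl⟩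

theorem IsFitting.le_radicalOf (hX : X.IsFitting) {G : Type u} [Group G] {K N : Subgroup G}
    (h : N ≤ K) (hn : ∀ k ∈ K, ∀ n ∈ N, k * n * k⁻¹ ∈ N) (hN : X N) : N ≤ X.radicalOf K := by
  have h1 : N.subgroupOf K ≤ X.radical K :=
    le_radical ⟨fun n hn' k => hn k k.2 n hn'⟩ ((hX.subgroupOf_iff h).2 hN)
  intro x hx
  exact ⟨⟨x, h hx⟩, h1 hx, rfl⟩

theorem IsFitting.conj_mem_radicalOf_of_normalized (hX : X.IsFitting) (hne : X.IsNonempty)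
    {G : Type u} [Group G] [Finite G] {H : Subgroup G} {g : G} (hg : ∀ h, h ∈ H ↔ g * h * g⁻¹ ∈ H)
    {x : G} (hx : x ∈ X.radicalOf H) : g * x * g⁻¹ ∈ X.radicalOf H := by
  have h1 : (X.radicalOf H).map (MulAut.conj g).toMonoidHom ≤ X.radicalOf H := by
    refine hX.le_radicalOf ?_ ?_ ((hX.map_iff _ _ (MulAut.conj g).injective).2
      (hX.radicalOf_mem hne H))
    · rintro _ ⟨y, hy, rfl⟩
      exact (hg y).1 (radicalOf_le H hy)
    · rintro k hk _ ⟨y, hy, rfl⟩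
      have hk' : g⁻¹ * k * g ∈ H := (hg _).2 (by simpa [mul_assoc] using hk)
      exact ⟨_, conj_mem_radicalOf hk' hy, by simp [mul_assoc]⟩
  exact h1 ⟨x, hx, rfl⟩

theorem IsFitting.radicalOf_mono (hX : X.IsFitting) (hne : X.IsNonempty) {G : Type u} [Group G]
    [Finite G] {H K : Subgroup G} (h : H ≤ K) (hn : ∀ k ∈ K, ∀ x ∈ H, k * x * k⁻¹ ∈ H) :
    X.radicalOf H ≤ X.radicalOf K := by
  refine hX.le_radicalOf ((radicalOf_le H).trans h) (fun k hk n hn' => ?_) (hX.radicalOf_mem hne H)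
  refine hX.conj_mem_radicalOf_of_normalized hne (fun x => ⟨hn k hk x, fun hx => ?_⟩) hn'
  simpa [mul_assoc] using hn k⁻¹ (inv_mem hk) _ hx

/-- The radical of a normal subgroup is invariant under conjugation in the larger group, so radicals
grow along each step of a subnormal chain. -/
theorem IsFitting.radicalOf_le_radical (hX : X.IsFitting) (hne : X.IsNonempty) {G : Type u}
    [Group G] [Finite G] {H : Subgroup G} (hH : H.IsSubnormal) :
    X.radicalOf H ≤ X.radical G := by
  induction hH with
  | top =>
    exact le_radical ⟨fun n hn g => conj_mem_radicalOf (Subgroup.mem_top g) hn⟩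
      (hX.radicalOf_mem hne ⊤)
  | step H K h_le hSubn hN ih =>
    refine le_trans (hX.radicalOf_mono hne h_le fun k hk x hx => ?_) ih
    exact hN.conj_mem ⟨x, h_le hx⟩ hx ⟨k, hk⟩

theorem IsFitting.le_radical_of_isSubnormal (hX : X.IsFitting) (hne : X.IsNonempty) {G : Type u}
    [Group G] [Finite G] {H : Subgroup G} (hH : H.IsSubnormal) (h : X H) : H ≤ X.radical G :=
  (hX.le_radicalOf le_rfl (fun _ hk _ hn => mul_mem (mul_mem hk hn) (inv_mem hk)) h).trans
    (hX.radicalOf_le_radical hne hH)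

end GroupClass

/-! ### Products of classes, and the class of π-nilpotent groups. -/

namespace GroupClass

variable {X H A B : GroupClass.{u}}

/-- Membership test that avoids computing the radical: the kernel lies in it, so the radical
quotient is a quotient of the image of `f`. -/
theorem IsSQClosed.prod_of_hom (hH : H.IsSQClosed) {G Q : Type u} [Group G] [Finite G]
    [Group Q] (f : G →* Q) (hf : X f.ker) (hQ : H Q) : X.prod H G :=
  ⟨‹_›, hH.of_ker_le f (QuotientGroup.mk' (X.radical G)) (QuotientGroup.mk'_surjective _)
    (by rw [QuotientGroup.ker_mk']; exact le_radical inferInstance hf) hQ⟩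

theorem IsFitting.prod_of_hom (hX : X.IsFitting) (hH : H.IsSQClosed) {G Q : Type u} [Group G]
    [Finite G] [Group Q] {K N : Subgroup G} (f : G →* Q) (hf : ∀ k ∈ K, k ∈ N ↔ f k = 1)
    (hNK : N ≤ K) (hN : X N) (hQ : H Q) : X.prod H K := by
  refine hH.prod_of_hom (f.comp K.subtype) ?_ hQ
  have : (f.comp K.subtype).ker = N.subgroupOf K := by
    ext x
    rw [Subgroup.mem_subgroupOf, hf x x.2]
    rfl
  rw [this]
  exact (hX.subgroupOf_iff hNK).2 hN

theorem IsSQClosed.prod (hX : A.IsFitting) (hne : A.IsNonempty) (hA : A.IsSQClosed)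
    (hB : B.IsSQClosed) : (A.prod B).IsSQClosed where
  subgroup G _ K h := by
    obtain ⟨_, h⟩ := h
    refine hX.prod_of_hom hB (N := A.radical G ⊓ K) (QuotientGroup.mk' (A.radical G))
      (fun k hk => ?_) inf_le_right ?_ h
    · simp [hk]
    · exact hA.of_injective _ (Subgroup.inclusion_injective inf_le_left) (hX.radical_mem hne G)
  quotient G Q _ _ f hf h := by
    obtain ⟨_, h⟩ := h
    have := Finite.of_surjective f hf
    have hn : ((A.radical G).map f).Normal := (A.radical_normal G).map f hf
    have h1 : A ((A.radical G).map f) :=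
      hA.quotient _ _ (f.subgroupMap (A.radical G)) (f.subgroupMap_surjective _)
        (hX.radical_mem hne G)
    refine hB.prod_of_hom (QuotientGroup.mk' ((A.radical G).map f))
      (by rwa [QuotientGroup.ker_mk']) ?_
    refine hB.of_ker_le (QuotientGroup.mk' (A.radical G))
      ((QuotientGroup.mk' ((A.radical G).map f)).comp f)
      ((QuotientGroup.mk'_surjective _).comp hf) ?_ h
    rw [← MonoidHom.comap_ker, QuotientGroup.ker_mk', QuotientGroup.ker_mk']
    exact Subgroup.le_comap_map _ _

theorem IsFitting.prod_of_sup_eq_top (hX : X.IsFitting) (hne : X.IsNonempty) (hF : H.IsFitting)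
    (hH : H.IsSQClosed) {G : Type u} [Group G] [Finite G] {M N : Subgroup G} (hM : M.Normal)
    (hN : N.Normal) (hMN : M ⊔ N = ⊤) (hM' : X.prod H M) (hN' : X.prod H N) : X.prod H G := by
  refine ⟨‹_›, ?_⟩
  set f := QuotientGroup.mk' (X.radical G) with hf
  have hs : Function.Surjective f := QuotientGroup.mk'_surjective _
  have key : ∀ K : Subgroup G, K.Normal → X.prod H K → H (K.map f) := by
    intro K hK h
    refine hH.of_ker_le (QuotientGroup.mk' (X.radical K)) (f.subgroupMap K)
      (f.subgroupMap_surjective K) ?_ h.2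
    rw [QuotientGroup.ker_mk']
    intro x hx
    have : (x : G) ∈ X.radical G := hX.radicalOf_le_radical hne hK.isSubnormal ⟨x, hx, rfl⟩
    rw [MonoidHom.mem_ker]
    exact Subtype.ext ((QuotientGroup.eq_one_iff _).2 this)
  have h := hF.sup _ (M.map f) (N.map f) (hM.map f hs) (hN.map f hs) (key M hM hM') (key N hN hN')
  rw [← Subgroup.map_sup, hMN, Subgroup.map_top_of_surjective f hs] at h
  exact hF.top_iff.1 h

theorem IsFitting.prod_iso (hX : X.IsFitting) (hne : X.IsNonempty) (hH : H.IsSQClosed)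
    {G G' : Type u} [Group G] [Group G'] (e : G ≃* G') (h : X.prod H G) : X.prod H G' := by
  obtain ⟨_, h⟩ := h
  have := Finite.of_equiv G e.toEquiv
  refine hH.prod_of_hom ((QuotientGroup.mk' (X.radical G)).comp e.symm.toMonoidHom) ?_ h
  rw [← MonoidHom.comap_ker, QuotientGroup.ker_mk', MulEquiv.toMonoidHom_eq_coe,
    ← Subgroup.map_equiv_eq_comap_symm]
  exact (hX.map_iff _ _ e.injective).2 (hX.radical_mem hne G)

theorem IsFitting.prod (hX : X.IsFitting) (hne : X.IsNonempty) (hF : H.IsFitting)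
    (hH : H.IsSQClosed) : (X.prod H).IsFitting where
  finite G _ h := h.1
  iso G G' _ _ e h := hX.prod_iso hne hH e.some h
  normal G _ N hN h := by
    obtain ⟨_, h⟩ := h
    refine hX.prod_of_hom hH (N := X.radical G ⊓ N) (QuotientGroup.mk' (X.radical G))
      (fun k hk => by simp [hk]) inf_le_right ?_ h
    exact hX.of_normalized inf_le_left
      (fun l hl k hk => (inferInstance : (X.radical G ⊓ N).Normal).conj_mem k hk l)
      (hX.radical_mem hne G)
  sup G _ _ M N hM hN hM' hN' := by
    refine hX.prod_of_sup_eq_top hne hF hH (hM.comap _) (hN.comap _) ?_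
      (hX.prod_iso hne hH (Subgroup.subgroupOfEquivOfLe (le_sup_left : M ≤ M ⊔ N)).symm hM')
      (hX.prod_iso hne hH (Subgroup.subgroupOfEquivOfLe (le_sup_right : N ≤ M ⊔ N)).symm hN')
    exact (Subgroup.subgroupOf_sup le_sup_left le_sup_right).symm.trans (Subgroup.subgroupOf_self _)

theorem IsFitting.prod_isNonempty (hX : X.IsFitting) (hne : X.IsNonempty) (hF : H.IsFitting)
    (hFne : H.IsNonempty) (hH : H.IsSQClosed) : (X.prod H).IsNonempty := by
  refine ⟨(⊥ : Subgroup PUnit), inferInstance, hX.prod_of_hom hH (N := ⊥)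
    (1 : PUnit.{u + 1} →* (⊥ : Subgroup PUnit.{u + 1})) ?_ le_rfl (hX.bot hne _) (hF.bot hFne _)⟩
  simp

/-- Describing p-nilpotency as a product of classes lets π-nilpotent groups inherit their closure
properties from the results on products. -/
theorem isPNilpotent_iff (p : Nat.Primes) (G : Type u) [Group G] :
    Finite G ∧ IsPNilpotent p G ↔ prod (IsPiGroup.{u} {p}ᶜ) (IsPiGroup.{u} {p}) G := by
  constructor
  · rintro ⟨_, N, hN, h1, h2⟩
    refine (isSQClosed_isPiGroup _).prod_of_hom (QuotientGroup.mk' N)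
      (by rwa [QuotientGroup.ker_mk']) ⟨inferInstance, fun q hq => ?_⟩
    simpa using h2 q hq
  · rintro ⟨_, h⟩
    refine ⟨‹_›, radical _ G, inferInstance,
      (isFitting_isPiGroup _).radical_mem (isNonempty_isPiGroup _) G, fun q hq => ?_⟩
    simpa using h.2 q hq

theorem piNilpotent_iff (π : Set Nat.Primes) (G : Type u) [Group G] :
    piNilpotent π G ↔
      Finite G ∧ ∀ p ∈ π, prod (IsPiGroup.{u} {p}ᶜ) (IsPiGroup.{u} {p}) G :=
  ⟨fun h => ⟨h.1, fun p hp => (isPNilpotent_iff p G).1 ⟨h.1, h.2 p hp⟩⟩,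
    fun h => ⟨h.1, fun p hp => ((isPNilpotent_iff p G).2 (h.2 p hp)).2⟩⟩

theorem isSQClosed_piNilpotent (π : Set Nat.Primes) : (piNilpotent.{u} π).IsSQClosed := by
  have h (p : Nat.Primes) := IsSQClosed.prod (isFitting_isPiGroup.{u} {p}ᶜ)
    (isNonempty_isPiGroup _) (isSQClosed_isPiGroup _) (isSQClosed_isPiGroup {p})
  refine ⟨fun G _ K hG => ?_, fun G Q _ _ f hf hG => ?_⟩
  · rw [piNilpotent_iff] at *
    have := hG.1
    exact ⟨inferInstance, fun p hp => (h p).subgroup G K (hG.2 p hp)⟩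
  · rw [piNilpotent_iff] at *
    have := hG.1
    exact ⟨Finite.of_surjective f hf, fun p hp => (h p).quotient G Q f hf (hG.2 p hp)⟩

theorem isFitting_piNilpotent (π : Set Nat.Primes) : (piNilpotent.{u} π).IsFitting := by
  have h (p : Nat.Primes) := IsFitting.prod (isFitting_isPiGroup.{u} {p}ᶜ)
    (isNonempty_isPiGroup _) (isFitting_isPiGroup {p}) (isSQClosed_isPiGroup {p})
  refine ⟨fun G _ hG => hG.1, fun G Q _ _ e hG => ?_, fun G _ N hN hG => ?_,
    fun G _ _ M N hM hN hM' hN' => ?_⟩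
  · rw [piNilpotent_iff] at *
    have := hG.1
    exact ⟨Finite.of_equiv G e.some.toEquiv, fun p hp => (h p).iso G Q e (hG.2 p hp)⟩
  · rw [piNilpotent_iff] at *
    have := hG.1
    exact ⟨inferInstance, fun p hp => (h p).normal G N hN (hG.2 p hp)⟩
  · rw [piNilpotent_iff] at *
    exact ⟨inferInstance, fun p hp => (h p).sup G M N hM hN (hM'.2 p hp) (hN'.2 p hp)⟩

end GroupClass

/-! ### Finite nilpotent groups: elements of coprime order and complements. -/

section Nilpotent

variable {G : Type u} [Group G]

theorem Subgroup.mem_of_pow_mem_of_coprime {K : Subgroup G} {x : G} {m n : ℕ} (h : m.Coprime n)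
    (hm : x ^ m ∈ K) (hn : x ^ n ∈ K) : x ∈ K := by
  have h1 := Nat.gcd_eq_gcd_ab m n
  rw [Nat.coprime_iff_gcd_eq_one.1 h] at h1
  have h2 : x = (x ^ m) ^ (m.gcdA n) * (x ^ n) ^ (m.gcdB n) := by
    rw [← zpow_natCast, ← zpow_natCast, ← zpow_mul, ← zpow_mul, ← zpow_add, ← h1]
    simp
  rw [h2]
  exact mul_mem (zpow_mem hm _) (zpow_mem hn _)

/-- An element of finite order lies in a subgroup as soon as all its powers of prime power order
do. -/
theorem Subgroup.mem_of_forall_prime_pow {K : Subgroup G} {n : ℕ} (hn : 0 < n) {x : G}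
    (hx : x ^ n = 1)
    (h : ∀ (p : Nat.Primes) (k m : ℕ), (x ^ m) ^ (p : ℕ) ^ k = 1 → x ^ m ∈ K) : x ∈ K := by
  induction n using Nat.recOnPosPrimePosCoprime generalizing x with
  | zero => exact absurd hn (lt_irrefl 0)
  | one => rw [← pow_one x, hx]; exact one_mem K
  | prime_pow p k hp hk => simpa using h ⟨p, hp⟩ k 1 (by simpa using hx)
  | coprime a b ha hb hab iha ihb =>
    refine mem_of_pow_mem_of_coprime hab ?_ ?_
    · refine ihb (by omega) (by rw [← pow_mul, hx]) fun p k m hm => ?_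
      rw [← pow_mul x] at hm ⊢
      exact h p k _ hm
    · refine iha (by omega) (by rw [← pow_mul, mul_comm b a, hx]) fun p k m hm => ?_
      rw [← pow_mul x] at hm ⊢
      exact h p k _ hm

theorem Group.IsNilpotent.commute_of_coprime [Finite G] [Group.IsNilpotent G] {x y : G} {m n : ℕ}
    (hmn : m.Coprime n) (hx : x ^ m = 1) (hy : y ^ n = 1) : Commute x y := by
  -- Entries 0 and 4 of the list are nilpotency and the decomposition as the direct product of the
  -- Sylow subgroups. In each factor, one of the two components is trivial.
  obtain ⟨e⟩ := ((Group.isNilpotent_of_finite_tfae (G := G)).out 0 4).1 ‹_›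
  obtain ⟨a, rfl⟩ := e.surjective x
  obtain ⟨b, rfl⟩ := e.surjective y
  have ha : a ^ m = 1 := e.injective (by rw [map_pow, hx, map_one])
  have hb : b ^ n = 1 := e.injective (by rw [map_pow, hy, map_one])
  refine Commute.map (f := e) ?_
  refine funext fun p => funext fun P => ?_
  have hp : (p : ℕ).Prime := Nat.prime_of_mem_primeFactors p.2
  have ha' : a p P ^ m = 1 := congrFun (congrFun ha p) P
  have hb' : b p P ^ n = 1 := congrFun (congrFun hb p) P
  have key : ∀ (z : P) (l : ℕ), z ^ l = 1 → (p : ℕ).Coprime l → z = 1 := by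
    intro z l hz hl
    obtain ⟨k, hk⟩ := P.isPGroup' z
    have := Nat.dvd_gcd (orderOf_dvd_of_pow_eq_one hk) (orderOf_dvd_of_pow_eq_one hz)
    rw [Nat.coprime_iff_gcd_eq_one.1 (Nat.Coprime.pow_left k hl)] at this
    exact orderOf_eq_one_iff.1 (Nat.dvd_one.1 this)
  by_cases h : (p : ℕ) ∣ m
  · have : (p : ℕ).Coprime n := Nat.Coprime.coprime_dvd_left h hmn
    simp [key _ n hb' this]
  · simp [key _ m ha' ((Nat.Prime.coprime_iff_not_dvd hp).2 h)]

/-- A finite nilpotent group has a normal `p`-complement. -/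
theorem Group.IsNilpotent.exists_normal_complement [Finite G] [Group.IsNilpotent G]
    (p : Nat.Primes) : ∃ D : Subgroup G, D.Normal ∧ IsPiGroup {p}ᶜ D ∧
      ∀ x : G, ∃ k, x ^ (p : ℕ) ^ k ∈ D := by
  have : Fact (p : ℕ).Prime := ⟨p.2⟩
  let P : Sylow (p : ℕ) G := default
  -- Schur–Zassenhaus; the complement is normal because the Sylow subgroup centralizes it.
  obtain ⟨D, hD⟩ := Subgroup.exists_right_complement'_of_coprime P.card_coprime_index
  obtain ⟨k, hk⟩ := P.isPGroup'.exists_card_eq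
  have hcard : ¬ (p : ℕ) ∣ Nat.card D := hD.card_right ▸ P.not_dvd_index
  have hcop : (Nat.card P).Coprime (Nat.card D) := by
    rw [hk]
    exact Nat.Coprime.pow_left k ((Nat.Prime.coprime_iff_not_dvd p.2).2 hcard)
  have hn : D.Normal := by
    refine ⟨fun d hd g => ?_⟩
    have hg : g ∈ (P : Subgroup G) ⊔ D := hD.sup_eq_top ▸ Subgroup.mem_top g
    obtain ⟨a, ha, b, hb, rfl⟩ := Subgroup.mem_sup_of_normal_left.1 hg
    have h1 : b * d * b⁻¹ ∈ D := mul_mem (mul_mem hb hd) (inv_mem hb)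
    have h2 : Commute a (b * d * b⁻¹) := commute_of_coprime hcop
      (orderOf_dvd_iff_pow_eq_one.1 (Subgroup.orderOf_dvd_natCard _ ha))
      (orderOf_dvd_iff_pow_eq_one.1 (Subgroup.orderOf_dvd_natCard _ h1))
    have h3 : a * b * d * (a * b)⁻¹ = b * d * b⁻¹ := by
      rw [show a * b * d * (a * b)⁻¹ = a * (b * d * b⁻¹) * a⁻¹ by group, h2.eq,
        mul_inv_cancel_right]
    rwa [h3]
  refine ⟨D, hn, ⟨inferInstance, fun q hq hqp => ?_⟩, fun x => ⟨k, ?_⟩⟩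
  · rw [Set.mem_singleton_iff] at hqp
    exact hcard (hqp ▸ hq)
  · have h1 : D.index = (p : ℕ) ^ k := hD.index_eq_card.trans hk
    exact h1 ▸ D.pow_index_mem x

end Nilpotent

/-! ### Splitting elements and nilpotent subgroups into p-parts and p'-parts. -/

section PrimaryParts

variable {G : Type u} [Group G]

theorem Nat.Primes.coprime_pow_of_not_dvd {p : Nat.Primes} {n : ℕ} (h : ¬ (p : ℕ) ∣ n) (k : ℕ) :
    ((p : ℕ) ^ k).Coprime n :=
  Nat.Coprime.pow_left k ((Nat.Prime.coprime_iff_not_dvd p.2).2 h)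

theorem Nat.Primes.not_dvd_orderOf {p q : Nat.Primes} (hpq : p ≠ q) {x : G} {k : ℕ}
    (h : x ^ (q : ℕ) ^ k = 1) : ¬ (p : ℕ) ∣ orderOf x := fun hd =>
  hpq (Subtype.ext ((Nat.prime_dvd_prime_iff_eq p.2 q.2).1
    (p.2.dvd_of_dvd_pow (hd.trans (orderOf_dvd_of_pow_eq_one h)))))

theorem eq_one_of_pow_prime_pow {p : Nat.Primes} {x : G} {k : ℕ} (h : x ^ (p : ℕ) ^ k = 1)
    (hx : ¬ (p : ℕ) ∣ orderOf x) : x = 1 := by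
  have h1 := Nat.Primes.coprime_pow_of_not_dvd hx k
  exact orderOf_eq_one_iff.1 (Nat.Coprime.eq_one_of_dvd h1.symm (orderOf_dvd_of_pow_eq_one h))

theorem exists_primary_decomposition [Finite G] (p : Nat.Primes) (x : G) :
    ∃ y ∈ Subgroup.zpowers x, ∃ z ∈ Subgroup.zpowers x,
      x = y * z ∧ (∃ k, y ^ (p : ℕ) ^ k = 1) ∧ ¬ (p : ℕ) ∣ orderOf z := by
  obtain ⟨k, t, ht, hn⟩ := Nat.exists_eq_pow_mul_and_not_dvd (orderOf_pos x).ne' (p : ℕ) p.2.ne_one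
  have h1 := Nat.gcd_eq_gcd_ab ((p : ℕ) ^ k) t
  rw [Nat.coprime_iff_gcd_eq_one.1 (Nat.Primes.coprime_pow_of_not_dvd ht k)] at h1
  set a := ((p : ℕ) ^ k).gcdA t
  set b := ((p : ℕ) ^ k).gcdB t
  have hx : x ^ ((p : ℕ) ^ k * t) = 1 := hn ▸ pow_orderOf_eq_one x
  refine ⟨(x ^ t) ^ b, zpow_mem (pow_mem (Subgroup.mem_zpowers x) _) _,
    (x ^ (p : ℕ) ^ k) ^ a, zpow_mem (pow_mem (Subgroup.mem_zpowers x) _) _, ?_, ⟨k, ?_⟩, ?_⟩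
  · rw [← zpow_natCast, ← zpow_natCast, ← zpow_mul, ← zpow_mul, ← zpow_add, add_comm, ← h1]
    simp
  · rw [← zpow_natCast, zpow_comm, zpow_natCast, ← pow_mul, mul_comm t, hx, one_zpow]
  · refine fun hd => ht (hd.trans (orderOf_dvd_of_pow_eq_one ?_))
    rw [← zpow_natCast, zpow_comm, zpow_natCast, ← pow_mul, hx, one_zpow]

theorem Subgroup.commute_of_isNilpotent [Finite G] {V : Subgroup G} (hV : Group.IsNilpotent V)
    {x y : G} (hx : x ∈ V) (hy : y ∈ V) {m n : ℕ} (hmn : m.Coprime n) (hxm : x ^ m = 1)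
    (hyn : y ^ n = 1) : Commute x y :=
  (Group.IsNilpotent.commute_of_coprime (x := (⟨x, hx⟩ : V)) (y := ⟨y, hy⟩) hmn
    (Subtype.ext hxm) (Subtype.ext hyn)).map V.subtype

/-- The p'-elements of a finite nilpotent group are exactly the elements of its normal p-complement.
-/
theorem Subgroup.not_dvd_orderOf_mul_of_isNilpotent [Finite G] {V : Subgroup G}
    (hV : Group.IsNilpotent V) (p : Nat.Primes) {x y : G} (hx : x ∈ V) (hy : y ∈ V)
    (hpx : ¬ (p : ℕ) ∣ orderOf x) (hpy : ¬ (p : ℕ) ∣ orderOf y) : ¬ (p : ℕ) ∣ orderOf (x * y) := by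
  obtain ⟨D, hn, hD, hk⟩ := Group.IsNilpotent.exists_normal_complement (G := V) p
  have key : ∀ z : V, ¬ (p : ℕ) ∣ orderOf z → z ∈ D := fun z hz => by
    obtain ⟨k, hk⟩ := hk z
    exact Subgroup.mem_of_pow_mem_of_coprime (Nat.Primes.coprime_pow_of_not_dvd hz k) hk
      (by rw [pow_orderOf_eq_one]; exact one_mem D)
  have h1 : (⟨x, hx⟩ * ⟨y, hy⟩ : V) ∈ D :=
    mul_mem (key _ (by rwa [Subgroup.orderOf_mk])) (key _ (by rwa [Subgroup.orderOf_mk]))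
  intro hd
  have h2 := Subgroup.orderOf_dvd_natCard D h1
  rw [← Subgroup.orderOf_coe] at h2
  exact hD.2 p (hd.trans h2) rfl

/-- The Sylow `p`-subgroup of a finite nilpotent subgroup. -/
theorem Subgroup.exists_primary_part [Finite G] {V : Subgroup G} (hV : Group.IsNilpotent V)
    (p : Nat.Primes) : ∃ S ≤ V, IsPGroup (p : ℕ) S ∧
      ∀ x ∈ V, (∃ k, x ^ (p : ℕ) ^ k = 1) → x ∈ S := by
  have : Fact (p : ℕ).Prime := ⟨p.2⟩
  let P : Sylow (p : ℕ) V := default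
  refine ⟨(P : Subgroup V).map V.subtype, Subgroup.map_subtype_le _, P.isPGroup'.map _, ?_⟩
  rintro x hx ⟨k, hk⟩
  have h1 : IsPGroup (p : ℕ) (Subgroup.zpowers (⟨x, hx⟩ : V)) := by
    refine IsPGroup.of_card_dvd_pow (n := k) ?_
    rw [Nat.card_zpowers, Subgroup.orderOf_mk]
    exact orderOf_dvd_of_pow_eq_one hk
  obtain ⟨Q, hQ⟩ := h1.exists_le_sylow
  have : Subsingleton (Sylow (p : ℕ) V) := (Sylow.unique_of_normal P inferInstance).instSubsingleton
  have h2 : (⟨x, hx⟩ : V) ∈ (P : Subgroup V) :=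
    Subsingleton.elim Q P ▸ hQ (Subgroup.mem_zpowers _)
  exact ⟨_, h2, rfl⟩

end PrimaryParts

/-! ### Nilpotent subgroups over a normal self-centralizing subgroup. -/

section SelfCentralizing

variable {H : Type u} [Group H]

/-- The centralizer of the set of `p'`-elements of `F`. -/
def Subgroup.primeCentralizer (F : Subgroup H) (p : Nat.Primes) : Subgroup H :=
  Subgroup.centralizer {x | x ∈ F ∧ ¬ (p : ℕ) ∣ orderOf x}

namespace Subgroup

variable {F : Subgroup H}

theorem mem_primeCentralizer {p : Nat.Primes} {c : H} :
    c ∈ F.primeCentralizer p ↔ ∀ y ∈ F, ¬ (p : ℕ) ∣ orderOf y → Commute y c :=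
  ⟨fun h y hy hp => h y ⟨hy, hp⟩, fun h y hy => h y hy.1 hy.2⟩

theorem primeCentralizer_normal (hF : F.Normal) (p : Nat.Primes) :
    (F.primeCentralizer p).Normal := by
  refine ⟨fun c hc g => mem_primeCentralizer.2 fun y hy hp => ?_⟩
  have h1 : orderOf (g⁻¹ * y * g) = orderOf y := by
    simpa using orderOf_injective (MulAut.conj g⁻¹).toMonoidHom (MulAut.conj g⁻¹).injective y
  have h2 := mem_primeCentralizer.1 hc (g⁻¹ * y * g) (by simpa using hF.conj_mem y hy g⁻¹)
    (by rwa [h1])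
  have h3 := h2.map (MulAut.conj g).toMonoidHom
  simpa [mul_assoc] using h3

/-- An element of prime power order is a p'-element or a q'-element, and such powers generate every
element of `F`. -/
theorem mem_centralizer_of_mem_primeCentralizer [Finite H] {p q : Nat.Primes} (hpq : p ≠ q) {z : H}
    (hp : z ∈ F.primeCentralizer p) (hq : z ∈ F.primeCentralizer q) :
    z ∈ centralizer (F : Set H) := by
  intro x hx
  have : x ∈ centralizer {z} := by
    refine mem_of_forall_prime_pow (orderOf_pos x) (pow_orderOf_eq_one x) fun r k m hr => ?_
    rw [mem_centralizer_singleton_iff]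
    by_cases h : p = r
    · exact (mem_primeCentralizer.1 hq _ (pow_mem hx m)
        (Nat.Primes.not_dvd_orderOf (fun h' => hpq (h.trans h'.symm)) hr))
    · exact (mem_primeCentralizer.1 hp _ (pow_mem hx m) (Nat.Primes.not_dvd_orderOf h hr))
  exact mem_centralizer_singleton_iff.1 this

/-- A `p`-subgroup centralizing the `p'`-elements of `F` and containing its `p`-elements. -/
structure IsPrimary (F : Subgroup H) (p : Nat.Primes) (P : Subgroup H) : Prop where
  isPGroup : IsPGroup (p : ℕ) P
  le : P ≤ F.primeCentralizer p
  mem : ∀ x ∈ F, (∃ k, x ^ (p : ℕ) ^ k = 1) → x ∈ P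

variable [Finite H]

/-- The commutator [c, a] lies in C_p ∩ C_q = C(F) ≤ F. Its p-part y belongs to `P`; its p'-part w
commutes with ya ∈ `P`. As cac⁻¹ = w(ya) has p-power order, w = 1. -/
theorem IsPrimary.conj_mem (hF : F.Normal) (hC : centralizer (F : Set H) ≤ F) {p q : Nat.Primes}
    (hpq : p ≠ q) {P : Subgroup H} (hP : F.IsPrimary p P) {c a : H}
    (hc : c ∈ F.primeCentralizer q) (ha : a ∈ P) : c * a * c⁻¹ ∈ P := by
  have hz : c * a * c⁻¹ * a⁻¹ ∈ F := by
    refine hC (mem_centralizer_of_mem_primeCentralizer hpq ?_ ?_)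
    · exact mul_mem ((primeCentralizer_normal hF p).conj_mem _ (hP.le ha) c) (inv_mem (hP.le ha))
    · have := mul_mem hc ((primeCentralizer_normal hF q).conj_mem _ (inv_mem hc) a)
      simpa [mul_assoc] using this
  obtain ⟨y, hy, w, hw, hyw, hyp, hwp⟩ := exists_primary_decomposition p (c * a * c⁻¹ * a⁻¹)
  have hyF : y ∈ F := (zpowers_le.2 hz) hy
  have hwF : w ∈ F := (zpowers_le.2 hz) hw
  have hya : y * a ∈ P := mul_mem (hP.mem y hyF hyp) ha
  have hcom : Commute w (y * a) := mem_primeCentralizer.1 (hP.le hya) w hwF hwp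
  have hcomm : Commute y w := by
    obtain ⟨i, rfl⟩ := hy
    obtain ⟨j, rfl⟩ := hw
    exact (Commute.refl _).zpow_zpow i j
  have heq : c * a * c⁻¹ = w * (y * a) := by
    rw [← mul_assoc, ← hcomm.eq, ← hyw, inv_mul_cancel_right]
  have : Fact (p : ℕ).Prime := ⟨p.2⟩
  obtain ⟨N, hN⟩ := hP.isPGroup.exists_card_eq
  have hpow : ∀ b ∈ P, b ^ (p : ℕ) ^ N = 1 := fun b hb =>
    orderOf_dvd_iff_pow_eq_one.1 (hN ▸ orderOf_dvd_natCard P hb)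
  have h1 : (c * a * c⁻¹) ^ (p : ℕ) ^ N = 1 := by rw [conj_pow, hpow a ha]; simp
  rw [heq, hcom.mul_pow, hpow _ hya, mul_one] at h1
  rw [heq, eq_one_of_pow_prime_pow h1 hwp, one_mul]
  exact hya

/-- `P` and `Q` normalize each other and meet trivially, so their commutators vanish. -/
theorem IsPrimary.commute (hF : F.Normal) (hC : centralizer (F : Set H) ≤ F) {p q : Nat.Primes}
    (hpq : p ≠ q) {P Q : Subgroup H} (hP : F.IsPrimary p P) (hQ : F.IsPrimary q Q) {a b : H}
    (ha : a ∈ P) (hb : b ∈ Q) : Commute a b := by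
  have : Fact (p : ℕ).Prime := ⟨p.2⟩
  have : Fact (q : ℕ).Prime := ⟨q.2⟩
  have hd := IsPGroup.disjoint_of_ne (p : ℕ) (q : ℕ) (fun h => hpq (Subtype.ext h))
    P Q hP.isPGroup hQ.isPGroup
  have h1 : a * b * a⁻¹ * b⁻¹ ∈ P := by
    have := mul_mem ha (hP.conj_mem hF hC hpq (hQ.le hb) (inv_mem ha))
    simpa [mul_assoc] using this
  have h2 : a * b * a⁻¹ * b⁻¹ ∈ Q :=
    mul_mem (hQ.conj_mem hF hC hpq.symm (hP.le ha) hb) (inv_mem hb)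
  have h3 := Subgroup.disjoint_def.1 hd h1 h2
  rw [mul_inv_eq_one, mul_inv_eq_iff_eq_mul] at h3
  exact h3

/-- The subgroups `P p` commute pairwise, so `Q`, their join over the primes dividing the order of
`H`, is an image of a direct product of p-groups. -/
theorem exists_isNilpotent_of_isPrimary (hF : F.Normal) (hC : centralizer (F : Set H) ≤ F)
    (P : Nat.Primes → Subgroup H) (hP : ∀ p, F.IsPrimary p (P p)) :
    ∃ Q : Subgroup H, Group.IsNilpotent Q ∧
      ∀ V : Subgroup H, (∀ p : Nat.Primes, ∀ x ∈ V, (∃ k, x ^ (p : ℕ) ^ k = 1) → x ∈ P p) → V ≤ Q := by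
  let ι := {p : Nat.Primes // (p : ℕ) ∣ Nat.card H}
  have : Finite ι := Finite.of_injective (β := (Nat.card H).divisors)
    (fun i => ⟨(i.1 : ℕ), Nat.mem_divisors.2 ⟨i.2, Nat.card_pos.ne'⟩⟩)
    (fun i j h => Subtype.ext (Subtype.ext (by simpa using h)))
  let := Fintype.ofFinite ι
  have hcomm : Pairwise fun i j : ι => ∀ x y : H, x ∈ P i → y ∈ P j → Commute x y :=
    fun i j hij x y hx hy =>
      (hP i).commute hF hC (fun h => hij (Subtype.ext h)) (hP j) hx hy
  have hnil : ∀ i : ι, Group.IsNilpotent (P i) := fun i => by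
    have : Fact (i.1 : ℕ).Prime := ⟨i.1.2⟩
    exact (hP i).isPGroup.isNilpotent
  refine ⟨⨆ i : ι, P i, ?_, fun V hV x hx => ?_⟩
  · rw [← noncommPiCoprod_range (hcomm := hcomm)]
    exact Group.nilpotent_of_surjective _ (noncommPiCoprod hcomm).rangeRestrict_surjective
  · refine mem_of_forall_prime_pow (orderOf_pos x) (pow_orderOf_eq_one x) fun p k m h => ?_
    by_cases hp : (p : ℕ) ∣ Nat.card H
    · exact (le_iSup (fun i : ι => P i) ⟨p, hp⟩) (hV p _ (pow_mem hx m) ⟨k, h⟩)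
    · rw [eq_one_of_pow_prime_pow h fun hd => hp (hd.trans (_root_.orderOf_dvd_natCard _))]
      exact one_mem _

theorem mem_primeCentralizer_of_isNilpotent {V : Subgroup H} (hV : Group.IsNilpotent V)
    (hFV : F ≤ V) {p : Nat.Primes} {x : H} (hx : x ∈ V) {k : ℕ} (hk : x ^ (p : ℕ) ^ k = 1) :
    x ∈ F.primeCentralizer p :=
  mem_primeCentralizer.2 fun y hy hp => (commute_of_isNilpotent hV hx (hFV hy)
    (Nat.Primes.coprime_pow_of_not_dvd hp k) hk (pow_orderOf_eq_one y)).symm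

/-- The Sylow p-subgroup of `V` lies in C_p. Enlarging it to a Sylow subgroup of C_p makes Sylow
conjugacy available there. -/
theorem exists_sylow_isPrimary {V : Subgroup H} (hV : Group.IsNilpotent V) (hFV : F ≤ V)
    (p : Nat.Primes) : ∃ P : Sylow (p : ℕ) (F.primeCentralizer p),
      F.IsPrimary p ((P : Subgroup (F.primeCentralizer p)).map (F.primeCentralizer p).subtype) ∧
      ∀ x ∈ V, (∃ k, x ^ (p : ℕ) ^ k = 1) →
        x ∈ (P : Subgroup (F.primeCentralizer p)).map (F.primeCentralizer p).subtype := by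
  obtain ⟨S, hSV, hS, hSx⟩ := exists_primary_part hV p
  have hSC : S ≤ F.primeCentralizer p := fun x hx => by
    obtain ⟨k, hk⟩ := hS ⟨x, hx⟩
    exact mem_primeCentralizer_of_isNilpotent hV hFV (hSV hx) (congrArg Subtype.val hk)
  obtain ⟨P, hP⟩ := (hS.comap_subtype (K := F.primeCentralizer p)).exists_le_sylow
  have h1 : ∀ x ∈ V, (∃ k, x ^ (p : ℕ) ^ k = 1) →
      x ∈ (P : Subgroup (F.primeCentralizer p)).map (F.primeCentralizer p).subtype :=
    fun x hx hk => ⟨⟨x, hSC (hSx x hx hk)⟩, hP (hSx x hx hk), rfl⟩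
  exact ⟨P, ⟨P.isPGroup'.map _, map_subtype_le _, fun x hx => h1 x (hFV hx)⟩, h1⟩

/-- Any two nilpotent subgroups containing a normal self-centralizing subgroup `F` generate
a nilpotent subgroup after conjugating one of them. -/
theorem exists_conj_le_isNilpotent (hF : F.Normal) (hC : centralizer (F : Set H) ≤ F)
    {V W : Subgroup H} (hV : Group.IsNilpotent V) (hW : Group.IsNilpotent W) (hFV : F ≤ V)
    (hFW : F ≤ W) : ∃ (g : H) (Q : Subgroup H), Group.IsNilpotent Q ∧ V ≤ Q ∧
      ∀ w ∈ W, g * w * g⁻¹ ∈ Q := by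
  choose P' hP hPV using exists_sylow_isPrimary hV hFV
  choose R' hR hRW using exists_sylow_isPrimary hW hFW
  set P : Nat.Primes → Subgroup H := fun p =>
    (P' p : Subgroup (F.primeCentralizer p)).map (F.primeCentralizer p).subtype with hPdef
  set R : Nat.Primes → Subgroup H := fun p =>
    (R' p : Subgroup (F.primeCentralizer p)).map (F.primeCentralizer p).subtype with hRdef
  have hconj : ∀ q, ∃ c ∈ F.primeCentralizer q, ∀ x ∈ R q, c * x * c⁻¹ ∈ P q := by
    intro q
    have : Fact (q : ℕ).Prime := ⟨q.2⟩
    obtain ⟨c, hc⟩ := MulAction.exists_smul_eq (F.primeCentralizer q) (R' q) (P' q)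
    refine ⟨c, c.2, ?_⟩
    rintro _ ⟨x, hx, rfl⟩
    refine ⟨c * x * c⁻¹, ?_, rfl⟩
    rw [← hc]
    exact ⟨x, hx, rfl⟩
  -- Induction over primes: the new factor c ∈ C_q carries `R q` into `P q`, and by
  -- `IsPrimary.conj_mem` it keeps the `P p` and `R p` with p ≠ q in place.
  have key : ∀ s : Finset Nat.Primes, ∃ g : H, (∀ p ∈ s, ∀ x ∈ R p, g * x * g⁻¹ ∈ P p) ∧
      ∀ p ∉ s, ∀ x ∈ R p, g * x * g⁻¹ ∈ R p := by
    intro s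
    induction s using Finset.induction_on with
    | empty => exact ⟨1, by simp, by simp⟩
    | insert q s hq ih =>
      obtain ⟨g, h1, h2⟩ := ih
      obtain ⟨c, hc, h3⟩ := hconj q
      have e : ∀ x, c * g * x * (c * g)⁻¹ = c * (g * x * g⁻¹) * c⁻¹ := fun x => by group
      refine ⟨c * g, fun p hp x hx => ?_, fun p hp x hx => ?_⟩
      · rw [e]
        rcases Finset.mem_insert.1 hp with rfl | hp
        · exact h3 _ (h2 p hq x hx)
        · exact (hP p).conj_mem hF hC (fun h : p = q => hq (h ▸ hp)) hc (h1 p hp x hx)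
      · rw [e]
        rw [Finset.mem_insert, not_or] at hp
        exact (hR p).conj_mem hF hC hp.1 hc (h2 p hp.2 x hx)
  have hfin : {p : Nat.Primes | (p : ℕ) ∣ Nat.card H}.Finite :=
    Set.Finite.of_finite_image (f := fun p : Nat.Primes => (p : ℕ))
      ((Nat.card H).divisors.finite_toSet.subset (by
        rintro _ ⟨p, hp, rfl⟩
        exact Finset.mem_coe.2 (Nat.mem_divisors.2 ⟨hp, Nat.card_pos.ne'⟩)))
      (fun a _ b _ h => Subtype.ext h)
  obtain ⟨g, hg, -⟩ := key hfin.toFinset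
  obtain ⟨Q, hQ, hQ'⟩ := exists_isNilpotent_of_isPrimary hF hC P hP
  refine ⟨g, Q, hQ, hQ' V hPV, ?_⟩
  have h1 : W.map (MulAut.conj g).toMonoidHom ≤ Q := by
    refine hQ' _ ?_
    rintro p _ ⟨x, hx, rfl⟩ ⟨k, hk⟩
    have hk' : x ^ (p : ℕ) ^ k = 1 :=
      (MulAut.conj g).injective ((map_pow (MulAut.conj g) x _).trans (hk.trans (map_one _).symm))
    by_cases hp : (p : ℕ) ∣ Nat.card H
    · exact hg p (hfin.mem_toFinset.2 hp) x (hRW p x hx ⟨k, hk'⟩)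
    · rw [eq_one_of_pow_prime_pow hk' fun hd => hp (hd.trans (_root_.orderOf_dvd_natCard _)), map_one]
      exact one_mem _
  exact fun w hw => h1 ⟨w, hw, rfl⟩

/-- A nilpotent subgroup of a normal subgroup `M` containing `F ⊓ M` generates a nilpotent
subgroup together with `F`. -/
theorem exists_isNilpotent_of_inf_le (hF : F.Normal) (hFn : Group.IsNilpotent F)
    (hC : centralizer (F : Set H) ≤ F) {M U : Subgroup H} (hM : M.Normal)
    (hU : Group.IsNilpotent U) (hFU : F ⊓ M ≤ U) (hUM : U ≤ M) :
    ∃ Q : Subgroup H, Group.IsNilpotent Q ∧ U ≤ Q ∧ F ≤ Q := by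
  -- For a p'-element y of `F`, z = [u, y] is a p'-element of `F ⊓ M ≤ U`, hence commutes with the
  -- p-element u. Then uⁿy = zⁿyuⁿ, and n = pᵏ gives z^(pᵏ) = 1, so z = 1.
  have hUC : ∀ (p : Nat.Primes) (u : H) (k : ℕ), u ∈ U → u ^ (p : ℕ) ^ k = 1 →
      u ∈ F.primeCentralizer p := by
    intro p u k hu huk
    refine mem_primeCentralizer.2 fun y hy hp => ?_
    have hord : orderOf (u * y * u⁻¹) = orderOf y :=
      orderOf_injective (MulAut.conj u).toMonoidHom (MulAut.conj u).injective y
    set z := u * y * u⁻¹ * y⁻¹ with hz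
    have hzp : ¬ (p : ℕ) ∣ orderOf z :=
      not_dvd_orderOf_mul_of_isNilpotent hFn p (hF.conj_mem y hy u) (inv_mem hy)
        (by rwa [hord]) (by rwa [orderOf_inv])
    have hzU : z ∈ U := by
      refine hFU ⟨mul_mem (hF.conj_mem y hy u) (F.inv_mem hy), ?_⟩
      have := mul_mem (hUM hu) (hM.conj_mem u⁻¹ (M.inv_mem (hUM hu)) y)
      simpa [hz, mul_assoc] using this
    have hcomm : Commute u z := commute_of_isNilpotent hU hu hzU
      (Nat.Primes.coprime_pow_of_not_dvd hzp k) huk (pow_orderOf_eq_one z)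
    have hpow : ∀ n : ℕ, u ^ n * y = z ^ n * y * u ^ n := by
      intro n
      induction n with
      | zero => simp
      | succ n ih =>
        have h1 : u * y = z * y * u := by simp [hz]
        rw [pow_succ', mul_assoc, ih, pow_succ' z, ← mul_assoc, ← mul_assoc,
          (hcomm.pow_right n).eq, mul_assoc (z ^ n), h1, ← pow_succ' z, pow_succ z]
        simp only [mul_assoc]
    have h2 := hpow ((p : ℕ) ^ k)
    rw [huk, one_mul, mul_one] at h2
    have h3 := eq_one_of_pow_prime_pow (right_eq_mul.1 h2) hzp
    rw [hz, mul_inv_eq_one, mul_inv_eq_iff_eq_mul] at h3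
    exact h3.symm
  have hex : ∀ p : Nat.Primes, ∃ P : Subgroup H, F.IsPrimary p P ∧
      ∀ x ∈ U, (∃ k, x ^ (p : ℕ) ^ k = 1) → x ∈ P := by
    intro p
    obtain ⟨S, hSU, hS, hSx⟩ := exists_primary_part hU p
    obtain ⟨T, hTF, hT, hTx⟩ := exists_primary_part hFn p
    have hTn : T.Normal := by
      refine ⟨fun t ht g => ?_⟩
      obtain ⟨k, hk⟩ := hT ⟨t, ht⟩
      refine hTx _ (hF.conj_mem t (hTF ht) g) ⟨k, ?_⟩
      rw [conj_pow, show t ^ (p : ℕ) ^ k = 1 from congrArg Subtype.val hk]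
      simp
    -- The primary subgroup for p is the product of the Sylow p-subgroups of `U` and `F`; the latter
    -- is normal in `H`.
    refine ⟨S ⊔ T, ⟨hS.to_sup_of_normal_right hT, sup_le (fun x hx => ?_) (fun x hx => ?_),
      fun x hx hk => (le_sup_right : T ≤ S ⊔ T) (hTx x hx hk)⟩,
      fun x hx hk => (le_sup_left : S ≤ S ⊔ T) (hSx x hx hk)⟩
    · obtain ⟨k, hk⟩ := hS ⟨x, hx⟩
      exact hUC p x k (hSU hx) (congrArg Subtype.val hk)
    · obtain ⟨k, hk⟩ := hT ⟨x, hx⟩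
      exact mem_primeCentralizer_of_isNilpotent hFn le_rfl (hTF hx) (congrArg Subtype.val hk)
  choose P hP hPU using hex
  obtain ⟨Q, hQ, hQ'⟩ := exists_isNilpotent_of_isPrimary hF hC P hP
  exact ⟨Q, hQ, hQ' U hPU, hQ' F fun p => (hP p).mem⟩

/-- For p ∉ σ, an element of order p in `Q` would centralize the σ-group `F`, hence lie in it. -/
theorem isPiGroup_of_isNilpotent {σ : Set Nat.Primes} (hC : centralizer (F : Set H) ≤ F)
    (hFσ : IsPiGroup σ F) {Q : Subgroup H} (hQ : Group.IsNilpotent Q) (hFQ : F ≤ Q) :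
    IsPiGroup σ Q := by
  refine ⟨inferInstance, fun p hp => by_contra fun hpσ => ?_⟩
  have : Fact (p : ℕ).Prime := ⟨p.2⟩
  obtain ⟨x, hx⟩ := exists_prime_orderOf_dvd_card' (p : ℕ) hp
  have hxp : (x : H) ^ (p : ℕ) ^ 1 = 1 := by
    rw [pow_one, ← hx, ← Subgroup.orderOf_coe, pow_orderOf_eq_one]
  have hxF : (x : H) ∈ F := by
    refine hC fun y hy => ?_
    have hyp : ¬ (p : ℕ) ∣ orderOf y := fun hd =>
      hpσ (hFσ.2 p (hd.trans (orderOf_dvd_natCard F hy)))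
    exact (commute_of_isNilpotent hQ x.2 (hFQ hy) (Nat.Primes.coprime_pow_of_not_dvd hyp 1) hxp
      (pow_orderOf_eq_one y)).symm
  refine hpσ (hFσ.2 p ?_)
  rw [← hx, ← Subgroup.orderOf_coe]
  exact orderOf_dvd_natCard F hxF

end Subgroup

end SelfCentralizing

/-! ### Rewriting the product with π-nilpotent groups. -/

namespace GroupClass

variable {X : GroupClass.{u}}

/-- The class of finite nilpotent `π`-groups. -/
def nilpotentPi (π : Set Nat.Primes) : GroupClass.{u} := fun G _ =>
  Group.IsNilpotent G ∧ IsPiGroup π G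

theorem isSQClosed_nilpotentPi (π : Set Nat.Primes) : (nilpotentPi.{u} π).IsSQClosed where
  subgroup G _ K h := by
    have := h.1
    exact ⟨inferInstance, (isSQClosed_isPiGroup π).subgroup G K h.2⟩
  quotient G Q _ _ f hf h := by
    have := h.1
    exact ⟨Group.nilpotent_of_surjective f hf, (isSQClosed_isPiGroup π).quotient G Q f hf h.2⟩

theorem IsFitting.prod_isPiGroup_of_pow_mem (σ : Set Nat.Primes) (G : Type u) [Group G] [Finite G]
    (h : ∀ x : G, ∃ n, IsPiNumber σ n ∧ x ^ n ∈ X.radical G) : X.prod (IsPiGroup σ) G := by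
  refine ⟨‹_›, isPiGroup_iff_pow.2 fun x => ?_⟩
  obtain ⟨x, rfl⟩ := QuotientGroup.mk_surjective x
  obtain ⟨n, hn, hx⟩ := h x
  exact ⟨n, hn, by rwa [← QuotientGroup.mk_pow, QuotientGroup.eq_one_iff]⟩

theorem exists_pow_mem_radical {σ : Set Nat.Primes} {G : Type u} [Group G]
    (h : X.prod (IsPiGroup σ) G) (x : G) : ∃ n, IsPiNumber σ n ∧ x ^ n ∈ X.radical G := by
  obtain ⟨_, h⟩ := h
  obtain ⟨n, hn, hx⟩ := isPiGroup_iff_pow.1 h (QuotientGroup.mk' (X.radical G) x)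
  exact ⟨n, hn, by rwa [← map_pow, QuotientGroup.mk'_apply, QuotientGroup.eq_one_iff] at hx⟩

/-- Extending an X-by-σ-group by a further σ-group gives nothing new. -/
theorem IsFitting.prod_isPiGroup_of_ker (hX : X.IsFitting) (hne : X.IsNonempty)
    {σ : Set Nat.Primes} {G A : Type u} [Group G] [Finite G] [Group A] (f : G →* A)
    (hf : X.prod (IsPiGroup σ) f.ker) (hA : IsPiGroup σ A) : X.prod (IsPiGroup σ) G := by
  have := hA.1
  refine prod_isPiGroup_of_pow_mem σ G fun x => ?_
  obtain ⟨n, hn, hx⟩ := isPiGroup_iff_pow.1 hA (f x)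
  obtain ⟨m, hm, hx'⟩ := exists_pow_mem_radical hf
    ⟨x ^ n, by rw [MonoidHom.mem_ker, map_pow, hx]⟩
  refine ⟨n * m, hn.mul hm, ?_⟩
  rw [pow_mul]
  exact hX.radicalOf_le_radical hne f.normal_ker.isSubnormal ⟨_, hx', rfl⟩

/-- Map to the product of the quotients Q/O_{p'}(Q) over the p ∈ π dividing |Q|. The kernel lies in
each of these O_{p'}(Q), so no p ∈ π divides its order. -/
theorem exists_hom_nilpotentPi {π : Set Nat.Primes} {Q : Type u} [Group Q]
    (h : piNilpotent π Q) : ∃ (A : Type u) (_ : Group A) (f : Q →* A),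
      nilpotentPi π A ∧ IsPiGroup πᶜ f.ker := by
  rw [piNilpotent_iff] at h
  obtain ⟨_, h⟩ := h
  let ι := {p : Nat.Primes // p ∈ π ∧ (p : ℕ) ∣ Nat.card Q}
  have : Finite ι := Finite.of_injective (β := (Nat.card Q).divisors)
    (fun i => ⟨(i.1 : ℕ), Nat.mem_divisors.2 ⟨i.2.2, Nat.card_pos.ne'⟩⟩)
    (fun i j h => Subtype.ext (Subtype.ext (by simpa using h)))
  let := Fintype.ofFinite ι
  let N : ι → Subgroup Q := fun i => radical (IsPiGroup {i.1}ᶜ) Q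
  have hq : ∀ i : ι, IsPiGroup {i.1} (Q ⧸ N i) := fun i => (h i.1 i.2.1).2
  have hnil : ∀ i : ι, Group.IsNilpotent (Q ⧸ N i) := fun i => by
    have : Fact (i.1 : ℕ).Prime := ⟨i.1.2⟩
    obtain ⟨k, hk⟩ := (hq i).isPiNumber_card.eq_pow
    exact (IsPGroup.of_card hk).isNilpotent
  refine ⟨∀ i : ι, Q ⧸ N i, inferInstance, MonoidHom.pi fun i => QuotientGroup.mk' (N i),
    ⟨inferInstance, isPiGroup_iff_pow.2 fun x => ?_⟩, ⟨inferInstance, fun p hp hpπ => ?_⟩⟩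
  · refine ⟨∏ i : ι, Nat.card (Q ⧸ N i), ?_, ?_⟩
    · exact Finset.prod_induction _ (IsPiNumber π) (fun _ _ => IsPiNumber.mul) (IsPiNumber.one π)
        fun i _ => (hq i).isPiNumber_card.mono (Set.singleton_subset_iff.2 i.2.1)
    · funext i
      obtain ⟨m, hm⟩ := Finset.dvd_prod_of_mem (fun i : ι => Nat.card (Q ⧸ N i))
        (Finset.mem_univ i)
      rw [hm, Pi.pow_apply, pow_mul, pow_card_eq_one', one_pow, Pi.one_apply]
  · let i : ι := ⟨p, hpπ, hp.trans (Subgroup.card_subgroup_dvd_card _)⟩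
    have hle : (MonoidHom.pi fun i => QuotientGroup.mk' (N i)).ker ≤ N i := fun x hx =>
      (QuotientGroup.eq_one_iff x).1 (congrFun hx i)
    have h1 : IsPiGroup {p}ᶜ (N i) :=
      (isFitting_isPiGroup _).radical_mem (isNonempty_isPiGroup _) Q
    exact h1.2 p (hp.trans (Subgroup.card_dvd_of_le hle)) rfl

theorem IsFitting.prod_piNilpotent_iff (hX : X.IsFitting) (hne : X.IsNonempty)
    (π : Set Nat.Primes) (G : Type u) [Group G] :
    X.prod (piNilpotent π) G ↔ (X.prod (IsPiGroup πᶜ)).prod (nilpotentPi π) G := by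
  constructor
  · rintro ⟨_, h⟩
    obtain ⟨A, _, f, hA, hf⟩ := exists_hom_nilpotentPi h
    refine (isSQClosed_nilpotentPi π).prod_of_hom (f.comp (QuotientGroup.mk' (X.radical G))) ?_ hA
    let g := ((QuotientGroup.mk' (X.radical G)).comp
      (f.comp (QuotientGroup.mk' (X.radical G))).ker.subtype).codRestrict f.ker fun x => x.2
    refine (isSQClosed_isPiGroup _).prod_of_hom g ?_ hf
    have hg : g.ker = (X.radical G).subgroupOf _ := by
      ext x
      rw [MonoidHom.mem_ker, Subgroup.mem_subgroupOf, ← QuotientGroup.eq_one_iff]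
      exact Subtype.ext_iff
    rw [hg]
    refine (hX.subgroupOf_iff fun x hx => ?_).2 (hX.radical_mem hne G)
    rw [MonoidHom.mem_ker, MonoidHom.comp_apply, QuotientGroup.mk'_apply,
      (QuotientGroup.eq_one_iff x).2 hx, map_one]
  · rintro ⟨_, h⟩
    have hEF := hX.prod hne (isFitting_isPiGroup πᶜ) (isSQClosed_isPiGroup πᶜ)
    have hEne := hX.prod_isNonempty hne (isFitting_isPiGroup πᶜ) (isNonempty_isPiGroup πᶜ)
      (isSQClosed_isPiGroup πᶜ)
    refine ⟨‹_›, (piNilpotent_iff _ _).2 ⟨inferInstance, fun p hp => ?_⟩⟩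
    set E := X.prod (IsPiGroup πᶜ) with hE
    have := h.1
    -- Lift the p-complement of the nilpotent quotient to `K` in G/G_X. Since p ∈ π, π'-numbers are
    -- p'-numbers, so `K` is a normal p'-subgroup whose quotient is a p-group.
    obtain ⟨D, hD, hD', hDk⟩ := Group.IsNilpotent.exists_normal_complement (G := G ⧸ E.radical G) p
    set r := QuotientGroup.mk' (X.radical G) with hr
    set K := (D.comap (QuotientGroup.mk' (E.radical G))).map r with hK
    have hKn : K.Normal := (hD.comap _).map r (QuotientGroup.mk'_surjective _)
    refine (isSQClosed_isPiGroup _).prod_of_hom (QuotientGroup.mk' K) ?_ ?_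
    · rw [QuotientGroup.ker_mk', isPiGroup_iff_pow]
      rintro ⟨_, x, hx, rfl⟩
      obtain ⟨n, hn, hxn⟩ := isPiGroup_iff_pow.1 hD' ⟨_, hx⟩
      have hxE : x ^ n ∈ E.radical G := by
        have := congrArg Subtype.val hxn
        rwa [Subgroup.coe_pow, ← map_pow, Subgroup.coe_one, QuotientGroup.mk'_apply,
          QuotientGroup.eq_one_iff] at this
      obtain ⟨m, hm, hxm⟩ := exists_pow_mem_radical (hEF.radical_mem hEne G) ⟨_, hxE⟩
      have hxX : (x ^ n) ^ m ∈ X.radical G :=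
        hX.radicalOf_le_radical hne (E.radical_normal G).isSubnormal ⟨_, hxm, rfl⟩
      refine ⟨n * m, hn.mul (hm.mono ?_), Subtype.ext ?_⟩
      · exact Set.compl_subset_compl.2 (Set.singleton_subset_iff.2 hp)
      · rw [Subgroup.coe_pow, ← map_pow, pow_mul]
        exact (QuotientGroup.eq_one_iff _).2 hxX
    · rw [isPiGroup_iff_pow]
      intro y
      obtain ⟨y, rfl⟩ := QuotientGroup.mk_surjective y
      obtain ⟨x, rfl⟩ := QuotientGroup.mk_surjective y
      obtain ⟨k, hk⟩ := hDk (QuotientGroup.mk' _ x)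
      refine ⟨_, IsPiNumber.singleton_pow p k, ?_⟩
      rw [← QuotientGroup.mk_pow, QuotientGroup.eq_one_iff, ← QuotientGroup.mk_pow]
      have h1 : QuotientGroup.mk' (E.radical G) (x ^ (p : ℕ) ^ k) ∈ D := by rwa [map_pow]
      exact ⟨_, h1, rfl⟩

theorem IsFitting.prod_piNilpotent_eq (hX : X.IsFitting) (hne : X.IsNonempty)
    (π : Set Nat.Primes) :
    X.prod (piNilpotent π) = (X.prod (IsPiGroup πᶜ)).prod (nilpotentPi π) :=
  funext fun G => funext fun _ => propext (hX.prod_piNilpotent_iff hne π G)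

end GroupClass

/-! ### Series witnessing π-solubility. -/

/-- Elementwise form of `π`-solubility. -/
def HasPiSeries (π : Set Nat.Primes) (G : Type u) [Group G] : Prop :=
  ∃ (m : ℕ) (S : ℕ → Subgroup G), S 0 = ⊥ ∧ S m = ⊤ ∧ ∀ i < m, S i ≤ S (i + 1) ∧
    (∀ g ∈ S (i + 1), ∀ x ∈ S i, g * x * g⁻¹ ∈ S i) ∧
    ∃ σ : Set Nat.Primes, (σ = πᶜ ∨ ∃ p ∈ π, σ = {p}) ∧
      ∀ x ∈ S (i + 1), ∃ n, IsPiNumber σ n ∧ x ^ n ∈ S i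

namespace HasPiSeries

variable {π : Set Nat.Primes} {G A : Type u} [Group G] [Group A]

theorem of_isPiSoluble (h : IsPiSoluble π G) : HasPiSeries π G := by
  obtain ⟨_, m, S, h0, h1, h⟩ := h
  refine ⟨m, S, h0, h1, fun i hi => ?_⟩
  obtain ⟨hle, hn, hf⟩ := h i hi
  refine ⟨hle, fun g hg x hx => hn.conj_mem ⟨x, hle hx⟩ hx ⟨g, hg⟩, ?_⟩
  have key : ∀ (x : S (i + 1)) (n : ℕ),
      (x : S (i + 1) ⧸ (S i).subgroupOf (S (i + 1))) ^ n = 1 → (x : G) ^ n ∈ S i := by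
    intro x n hx
    rw [← QuotientGroup.mk_pow, QuotientGroup.eq_one_iff] at hx
    exact hx
  rcases hf with ⟨p, hp, hf⟩ | hf
  · refine ⟨{p}, Or.inr ⟨p, hp, rfl⟩, fun x hx => ?_⟩
    obtain ⟨k, hk⟩ := hf (QuotientGroup.mk ⟨x, hx⟩)
    exact ⟨_, IsPiNumber.singleton_pow p k, key _ _ hk⟩
  · refine ⟨πᶜ, Or.inl rfl, fun x hx => ?_⟩
    obtain ⟨n, hn, hk⟩ := isPiGroup_iff_pow.1 hf (QuotientGroup.mk ⟨x, hx⟩)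
    exact ⟨n, hn, key _ _ hk⟩

theorem of_injective (h : HasPiSeries π G) (f : A →* G) (hf : Function.Injective f) :
    HasPiSeries π A := by
  obtain ⟨m, S, h0, h1, h⟩ := h
  refine ⟨m, fun i => (S i).comap f, ?_, ?_, fun i hi => ?_⟩
  · change (S 0).comap f = ⊥
    rw [h0, MonoidHom.comap_bot, MonoidHom.ker_eq_bot_iff]
    exact hf
  · change (S m).comap f = ⊤
    rw [h1, Subgroup.comap_top]
  · obtain ⟨hle, hn, σ, hσ, hp⟩ := h i hi
    refine ⟨Subgroup.comap_mono hle, fun g hg x hx => ?_, σ, hσ, fun x hx => ?_⟩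
    · simpa using hn _ hg _ hx
    · simpa using hp _ hx

theorem of_surjective (h : HasPiSeries π G) (f : G →* A) (hf : Function.Surjective f) :
    HasPiSeries π A := by
  obtain ⟨m, S, h0, h1, h⟩ := h
  refine ⟨m, fun i => (S i).map f, ?_, ?_, fun i hi => ?_⟩
  · change (S 0).map f = ⊥
    rw [h0, Subgroup.map_bot]
  · change (S m).map f = ⊤
    rw [h1, Subgroup.map_top_of_surjective f hf]
  · obtain ⟨hle, hn, σ, hσ, hp⟩ := h i hi
    refine ⟨Subgroup.map_mono hle, ?_, σ, hσ, ?_⟩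
    · rintro _ ⟨g, hg, rfl⟩ _ ⟨x, hx, rfl⟩
      exact ⟨_, hn g hg x hx, by simp⟩
    · rintro _ ⟨x, hx, rfl⟩
      obtain ⟨n, hn, hx⟩ := hp x hx
      exact ⟨n, hn, _, hx, by simp⟩

/-- The first nontrivial term of the series is a subnormal σ-group, so the σ-radical contains it. -/
theorem exists_radical_ne_bot [Finite G] [Nontrivial G] (h : HasPiSeries π G) :
    ∃ σ : Set Nat.Primes, (σ = πᶜ ∨ ∃ p ∈ π, σ = {p}) ∧
      GroupClass.radical (IsPiGroup σ) G ≠ ⊥ := by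
  obtain ⟨m, S, h0, h1, h⟩ := h
  have hsub : ∀ j ≤ m, (S (m - j)).IsSubnormal := by
    intro j
    induction j with
    | zero => intro _; rw [Nat.sub_zero, h1]; exact Subgroup.IsSubnormal.top
    | succ j ih =>
      intro hj
      have e : m - j = m - (j + 1) + 1 := by omega
      obtain ⟨hle, hn, -⟩ := h (m - (j + 1)) (by omega)
      refine Subgroup.IsSubnormal.step _ _ hle (e ▸ ih (by omega)) ⟨fun x hx g => ?_⟩
      exact hn g g.2 x hx
  classical
  have hex : ∃ i, S i ≠ ⊥ := ⟨m, by rw [h1]; exact top_ne_bot⟩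
  obtain ⟨i, hi⟩ : ∃ i, Nat.find hex = i + 1 := by
    refine Nat.exists_eq_succ_of_ne_zero fun h' => ?_
    have := Nat.find_spec hex
    rw [h'] at this
    exact this h0
  have hbot : S i = ⊥ := not_not.1 (Nat.find_min hex (m := i) (by omega))
  have hne : S (i + 1) ≠ ⊥ := hi ▸ Nat.find_spec hex
  have him : i < m := by
    have := Nat.find_min' hex (m := m) (by rw [h1]; exact top_ne_bot)
    omega
  obtain ⟨-, -, σ, hσ, hp⟩ := h i him
  refine ⟨σ, hσ, fun hr => hne (le_bot_iff.1 (hr ▸ ?_))⟩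
  have hs : (S (i + 1)).IsSubnormal := by
    have := hsub (m - (i + 1)) (by omega)
    rwa [show m - (m - (i + 1)) = i + 1 by omega] at this
  refine (GroupClass.isFitting_isPiGroup σ).le_radical_of_isSubnormal
    (GroupClass.isNonempty_isPiGroup σ) hs (isPiGroup_iff_pow.2 fun x => ?_)
  obtain ⟨n, hn, hx⟩ := hp x x.2
  rw [hbot, Subgroup.mem_bot] at hx
  exact ⟨n, hn, Subtype.ext hx⟩

end HasPiSeries

/-! ### Self-centralization of the largest normal nilpotent π-subgroup. -/

section Constraint

variable {π : Set Nat.Primes} {H : Type u} [Group H] [Finite H]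

/-- If `L` is a normal subgroup, a `π'`-group modulo its central `π`-subgroup `L ⊓ F`, and `H` has
no nontrivial normal `π'`-subgroup, then `L ≤ F`. -/
theorem Subgroup.le_of_pow_mem_center_of_compl
    (hO : GroupClass.radical (IsPiGroup πᶜ) H = ⊥) {F L : Subgroup H} (hF : IsPiGroup π F)
    (hL : L.Normal) (hc : ∀ z ∈ L, z ∈ F → ∀ x ∈ L, x * z = z * x)
    (hp : ∀ x ∈ L, ∃ n, IsPiNumber πᶜ n ∧ x ^ n ∈ F) : L ≤ F := by
  have hLc : IsPiGroup πᶜ (L ⧸ Subgroup.center L) := by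
    refine isPiGroup_iff_pow.2 fun y => ?_
    obtain ⟨x, rfl⟩ := QuotientGroup.mk_surjective y
    obtain ⟨n, hn, hx⟩ := hp x x.2
    refine ⟨n, hn, ?_⟩
    rw [← QuotientGroup.mk_pow, QuotientGroup.eq_one_iff, Subgroup.mem_center_iff]
    exact fun g => Subtype.ext (hc _ (L.pow_mem x.2 n) hx g g.2)
  have hd : IsPiNumber πᶜ (Subgroup.center L).index := hLc.isPiNumber_card
  intro x hx
  obtain ⟨n, hn, hxn⟩ := hp x hx
  -- Transfer into the center is g ↦ gᵈ, d being the index of the center, a π'-number. Its n-th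
  -- power has as kernel a normal π'-subgroup of `H`, hence is injective. A π-power xᵏ lies in this
  -- kernel, so xᵏ = 1, and coprimality of k and n puts x in `F`.
  let ψ : L →* Subgroup.center L :=
    { toFun := fun g => MonoidHom.transferCenterPow L g ^ n
      map_one' := by rw [map_one, one_pow]
      map_mul' := fun a b => by
        rw [map_mul]
        exact Commute.mul_pow (Subtype.ext (Subgroup.mem_center_iff.1 (Subtype.prop _) _)) n }
  have hψ : ∀ g : L, ((ψ g : L) : H) = (g : H) ^ ((Subgroup.center L).index * n) := by
    intro g
    simp [ψ, pow_mul]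
  have hmem : ∀ g : L, g ∈ ψ.ker ↔ (g : H) ^ ((Subgroup.center L).index * n) = 1 := by
    intro g
    rw [MonoidHom.mem_ker, ← hψ]
    simp
  have hK : ψ.ker.map L.subtype = ⊥ := by
    rw [← le_bot_iff, ← hO]
    refine GroupClass.le_radical ⟨?_⟩ (isPiGroup_iff_pow.2 ?_)
    · rintro _ ⟨y, hy, rfl⟩ g
      refine ⟨⟨g * y * g⁻¹, hL.conj_mem y y.2 g⟩, (hmem _).2 ?_, rfl⟩
      rw [conj_pow, (hmem y).1 hy]
      simp
    · rintro ⟨_, y, hy, rfl⟩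
      exact ⟨_, hd.mul hn, Subtype.ext ((hmem y).1 hy)⟩
  have hxF : x ^ ((Subgroup.center L).index * n) ∈ F := by
    rw [mul_comm, pow_mul]
    exact pow_mem hxn _
  obtain ⟨k, hk, hxk⟩ := isPiGroup_iff_pow.1 hF ⟨_, hxF⟩
  have h1 : x ^ k = 1 := by
    rw [← Subgroup.mem_bot, ← hK]
    refine ⟨⟨x ^ k, L.pow_mem hx k⟩, (hmem _).2 ?_, rfl⟩
    rw [← pow_mul, mul_comm, pow_mul]
    exact congrArg Subtype.val hxk
  exact Subgroup.mem_of_pow_mem_of_coprime (hn.coprime hk disjoint_compl_left) hxn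
    (h1 ▸ one_mem F)

theorem Subgroup.isNilpotent_of_pow_mem_center {p : Nat.Primes} {L Z : Subgroup H} (hZ : Z.Normal)
    (hc : ∀ z ∈ Z, ∀ x ∈ L, x * z = z * x)
    (hp : ∀ x ∈ L, ∃ n, IsPiNumber {p} n ∧ x ^ n ∈ Z) : Group.IsNilpotent L := by
  have : Fact (p : ℕ).Prime := ⟨p.2⟩
  set f := (QuotientGroup.mk' Z).comp L.subtype with hf
  have h1 : IsPGroup (p : ℕ) f.range := by
    rintro ⟨_, x, rfl⟩
    obtain ⟨n, hn, hx⟩ := hp x x.2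
    obtain ⟨k, rfl⟩ := hn.eq_pow
    exact ⟨k, Subtype.ext ((QuotientGroup.eq_one_iff _).2 hx)⟩
  have := h1.isNilpotent
  refine Subgroup.isNilpotent_of_ker_le_center f.rangeRestrict ?_
  rw [MonoidHom.ker_rangeRestrict]
  intro z hz
  rw [Subgroup.mem_center_iff]
  exact fun g => Subtype.ext (hc z ((QuotientGroup.eq_one_iff _).1 hz) g g.2)

/-- Otherwise C/(F ∩ C) has a nontrivial σ-radical, σ = π' or {p}, with preimage `L` not inside `F`.
But F ∩ C is central in `L`: if σ = π' the transfer argument gives L ≤ F, and if σ = {p} then `L` is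
a normal nilpotent π-group. The version relative to `M` serves subgroups that contain only T ∩ M. -/
theorem HasPiSeries.centralizer_inf_le (h : HasPiSeries π H)
    (hO : GroupClass.radical (IsPiGroup πᶜ) H = ⊥) {F : Subgroup H} (hFn : F.Normal)
    (hF : IsPiGroup π F)
    (hmax : ∀ N : Subgroup H, N.Normal → GroupClass.nilpotentPi π N → N ≤ F)
    {M : Subgroup H} (hM : M.Normal) :
    Subgroup.centralizer ((F ⊓ M : Subgroup H) : Set H) ⊓ M ≤ F := by
  set C := Subgroup.centralizer ((F ⊓ M : Subgroup H) : Set H) ⊓ M with hCdef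
  have hC : C.Normal := inferInstance
  have hZ : (F ⊓ C).Normal := inferInstance
  set r := QuotientGroup.mk' (F ⊓ C) with hr
  have hrs : Function.Surjective r := QuotientGroup.mk'_surjective _
  have hrk : ∀ x, r x = 1 ↔ x ∈ F ⊓ C := fun x => QuotientGroup.eq_one_iff x
  by_contra hne
  have hnt : Nontrivial (C.map r) := by
    rw [Subgroup.nontrivial_iff_ne_bot]
    intro hb
    refine hne fun x hx => ((hrk x).1 ?_).1
    rw [← Subgroup.mem_bot, ← hb]
    exact ⟨x, hx, rfl⟩
  obtain ⟨σ, hσ, hrad⟩ := ((h.of_surjective r hrs).of_injective (C.map r).subtype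
    (C.map r).subtype_injective).exists_radical_ne_bot
  have hYF := GroupClass.isFitting_isPiGroup.{u} σ
  have hYne := GroupClass.isNonempty_isPiGroup.{u} σ
  set R := GroupClass.radicalOf (IsPiGroup σ) (C.map r) with hRdef
  have hCr : (C.map r).Normal := hC.map r hrs
  have hRn : R.Normal := by
    refine ⟨fun x hx g => hYF.conj_mem_radicalOf_of_normalized hYne (fun y => ?_) hx⟩
    exact ⟨fun hy => hCr.conj_mem y hy g, fun hy => by
      simpa [mul_assoc] using hCr.conj_mem _ hy g⁻¹⟩
  have hRbot : R ≠ ⊥ := fun hb =>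
    hrad ((Subgroup.map_eq_bot_iff_of_injective _ (Subgroup.subtype_injective _)).1 hb)
  set L := R.comap r with hL
  have hLn : L.Normal := hRn.comap r
  have hLC : L ≤ C := by
    intro x hx
    obtain ⟨c, hc, hcx⟩ := GroupClass.radicalOf_le _ hx
    have : r (c⁻¹ * x) = 1 := by rw [map_mul, map_inv, hcx, inv_mul_cancel]
    simpa using mul_mem hc ((hrk _).1 this).2
  have hLF : ¬ L ≤ F := by
    intro hle
    refine hRbot (le_bot_iff.1 fun y hy => ?_)
    obtain ⟨x, rfl⟩ := hrs y
    exact (hrk x).2 ⟨hle hy, hLC hy⟩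
  have hcomm : ∀ z ∈ C, z ∈ F → ∀ x ∈ L, x * z = z * x := fun z hz hzF x hx =>
    ((hLC hx).1 z ⟨hzF, hz.2⟩).symm
  have hpow : ∀ x ∈ L, ∃ n, IsPiNumber σ n ∧ x ^ n ∈ F ⊓ C := by
    intro x hx
    obtain ⟨n, hn, h1⟩ := isPiGroup_iff_pow.1 (hYF.radicalOf_mem hYne (C.map r)) ⟨r x, hx⟩
    refine ⟨n, hn, (hrk _).1 ?_⟩
    rw [map_pow]
    exact congrArg Subtype.val h1
  rcases hσ with rfl | ⟨p, hp, rfl⟩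
  · refine hLF (Subgroup.le_of_pow_mem_center_of_compl hO hF hLn
      (fun z hz hzF => hcomm z (hLC hz) hzF) fun x hx => ?_)
    obtain ⟨n, hn, h1⟩ := hpow x hx
    exact ⟨n, hn, h1.1⟩
  · refine hLF (hmax L hLn ⟨Subgroup.isNilpotent_of_pow_mem_center hZ
      (fun z hz => hcomm z hz.2 hz.1) hpow, isPiGroup_iff_pow.2 fun x => ?_⟩)
    obtain ⟨n, hn, h1⟩ := hpow x x.2
    obtain ⟨m, hm, h2⟩ := isPiGroup_iff_pow.1 hF ⟨_, h1.1⟩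
    refine ⟨n * m, (hn.mono (Set.singleton_subset_iff.2 hp)).mul hm, Subtype.ext ?_⟩
    rw [Subgroup.coe_pow, pow_mul]
    exact congrArg Subtype.val h2

end Constraint

/-! ### Passing to the quotient by the `X.piExtension π`-radical. -/

namespace GroupClass

/-- The class of extensions of `X`-groups by `π'`-groups. -/
abbrev piExtension (X : GroupClass.{u}) (π : Set Nat.Primes) : GroupClass.{u} :=
  X.prod (IsPiGroup πᶜ)

/-- The class of extensions of groups in `X.piExtension π` by nilpotent `π`-groups. -/
abbrev nilpotentExtension (X : GroupClass.{u}) (π : Set Nat.Primes) : GroupClass.{u} :=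
  (X.piExtension π).prod (nilpotentPi π)

variable {X : GroupClass.{u}} {π : Set Nat.Primes}

theorem IsFitting.piExtension (hX : X.IsFitting) (hne : X.IsNonempty) :
    (X.piExtension π).IsFitting :=
  hX.prod hne (isFitting_isPiGroup πᶜ) (isSQClosed_isPiGroup πᶜ)

theorem IsFitting.piExtension_isNonempty (hX : X.IsFitting) (hne : X.IsNonempty) :
    (X.piExtension π).IsNonempty :=
  hX.prod_isNonempty hne (isFitting_isPiGroup πᶜ) (isNonempty_isPiGroup πᶜ)
    (isSQClosed_isPiGroup πᶜ)

theorem isNonempty_piNilpotent : (piNilpotent.{u} π).IsNonempty := by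
  refine ⟨PUnit, inferInstance, inferInstance, fun p _ => ⟨⊤, inferInstance,
    ⟨inferInstance, fun q hq => ?_⟩, fun q hq => ?_⟩⟩
  · exact absurd (Nat.dvd_one.1 (by simpa using hq)) q.2.one_lt.ne'
  · exact absurd (Nat.dvd_one.1 (by simpa using hq)) q.2.one_lt.ne'

theorem IsFitting.nilpotentExtension (hX : X.IsFitting) (hne : X.IsNonempty) :
    (X.nilpotentExtension π).IsFitting := by
  rw [GroupClass.nilpotentExtension, ← hX.prod_piNilpotent_eq hne π]
  exact hX.prod hne (isFitting_piNilpotent π) (isSQClosed_piNilpotent π)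

theorem IsFitting.nilpotentExtension_isNonempty (hX : X.IsFitting) (hne : X.IsNonempty) :
    (X.nilpotentExtension π).IsNonempty := by
  rw [GroupClass.nilpotentExtension, ← hX.prod_piNilpotent_eq hne π]
  exact hX.prod_isNonempty hne (isFitting_piNilpotent π) isNonempty_piNilpotent
    (isSQClosed_piNilpotent π)

variable {G : Type u} [Group G]

theorem subgroupComap_ker (N : Subgroup G) [N.Normal] (Q : Subgroup (G ⧸ N)) :
    ((QuotientGroup.mk' N).subgroupComap Q).ker =
      N.subgroupOf (Q.comap (QuotientGroup.mk' N)) := by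
  ext x
  rw [MonoidHom.mem_ker, Subgroup.mem_subgroupOf, ← QuotientGroup.eq_one_iff]
  exact Subtype.ext_iff

theorem IsFitting.subgroupComap_ker_iff {Y : GroupClass.{u}} (hY : Y.IsFitting) (N : Subgroup G)
    [N.Normal] (Q : Subgroup (G ⧸ N)) : Y ((QuotientGroup.mk' N).subgroupComap Q).ker ↔ Y N := by
  rw [subgroupComap_ker]
  refine hY.subgroupOf_iff fun x hx => ?_
  rw [Subgroup.mem_comap, QuotientGroup.mk'_apply, (QuotientGroup.eq_one_iff x).2 hx]
  exact one_mem Q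

/-- The hypothesis `hVO` makes the image of `V` a quotient of `V` by its own `X.piExtension
π`-radical. -/
theorem nilpotentPi_map {V : Subgroup G} (hV : X.nilpotentExtension π V)
    (hVO : (X.piExtension π).radicalOf V ≤ (X.piExtension π).radical G) :
    nilpotentPi π (V.map (QuotientGroup.mk' ((X.piExtension π).radical G))) := by
  set r := QuotientGroup.mk' ((X.piExtension π).radical G) with hr
  refine (isSQClosed_nilpotentPi π).of_ker_le (QuotientGroup.mk' ((X.piExtension π).radical V))
    (r.subgroupMap V) (r.subgroupMap_surjective V) ?_ hV.2
  rw [QuotientGroup.ker_mk']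
  intro x hx
  exact Subtype.ext ((QuotientGroup.eq_one_iff (x : G)).2 (hVO ⟨x, hx, rfl⟩))

theorem map_radical_normal :
    (((X.nilpotentExtension π).radical G).map
      (QuotientGroup.mk' ((X.piExtension π).radical G))).Normal :=
  (radical_normal _ _).map _ (QuotientGroup.mk'_surjective _)

variable [Finite G]

theorem IsFitting.radical_piExtension_le (hX : X.IsFitting) (hne : X.IsNonempty) :
    (X.piExtension π).radical G ≤ (X.nilpotentExtension π).radical G := by
  refine le_radical inferInstance ((hX.piExtension hne).prod_of_hom (isSQClosed_nilpotentPi π)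
    (N := (X.piExtension π).radical G) (1 : G →* (⊥ : Subgroup G)) (fun k hk => by simpa)
    le_rfl ((hX.piExtension hne).radical_mem (hX.piExtension_isNonempty hne) G)
    ⟨inferInstance, isPiGroup_iff_pow.2 fun x => ⟨1, IsPiNumber.one π, Subsingleton.elim _ _⟩⟩)

theorem IsFitting.nilpotentExtension_comap (hX : X.IsFitting) (hne : X.IsNonempty)
    {Q : Subgroup (G ⧸ (X.piExtension π).radical G)} (hQ : nilpotentPi π Q) :
    X.nilpotentExtension π (Q.comap (QuotientGroup.mk' ((X.piExtension π).radical G))) := by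
  exact (isSQClosed_nilpotentPi π).prod_of_hom
    ((QuotientGroup.mk' ((X.piExtension π).radical G)).subgroupComap Q)
    (((hX.piExtension hne).subgroupComap_ker_iff _ Q).2
      ((hX.piExtension hne).radical_mem (hX.piExtension_isNonempty hne) G)) hQ

theorem IsFitting.radical_quotient_eq_bot (hX : X.IsFitting) (hne : X.IsNonempty) :
    radical (IsPiGroup πᶜ) (G ⧸ (X.piExtension π).radical G) = ⊥ := by
  set r := QuotientGroup.mk' ((X.piExtension π).radical G) with hr
  set Q := radical (IsPiGroup πᶜ) (G ⧸ (X.piExtension π).radical G) with hQdef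
  have hQ : IsPiGroup πᶜ Q :=
    (isFitting_isPiGroup _).radical_mem (isNonempty_isPiGroup _) _
  have h1 : X.piExtension π (Q.comap r) :=
    hX.prod_isPiGroup_of_ker hne (r.subgroupComap Q)
      (((hX.piExtension hne).subgroupComap_ker_iff _ Q).2
        ((hX.piExtension hne).radical_mem (hX.piExtension_isNonempty hne) G)) hQ
  have h2 : Q.comap r ≤ (X.piExtension π).radical G := le_radical inferInstance h1
  refine le_bot_iff.1 fun y hy => ?_
  obtain ⟨x, rfl⟩ := QuotientGroup.mk'_surjective _ y
  exact (QuotientGroup.eq_one_iff x).2 (h2 hy)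

theorem IsFitting.nilpotentPi_map_radical (hX : X.IsFitting) (hne : X.IsNonempty) :
    nilpotentPi π (((X.nilpotentExtension π).radical G).map
      (QuotientGroup.mk' ((X.piExtension π).radical G))) :=
  nilpotentPi_map ((hX.nilpotentExtension hne).radical_mem (hX.nilpotentExtension_isNonempty hne) G)
    ((hX.piExtension hne).radicalOf_le_radical (hX.piExtension_isNonempty hne)
      (radical_normal _ _).isSubnormal)

theorem IsFitting.centralizer_inf_le (hX : X.IsFitting) (hne : X.IsNonempty)
    (hG : HasPiSeries π G) {M : Subgroup (G ⧸ (X.piExtension π).radical G)} (hM : M.Normal) :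
    Subgroup.centralizer (((((X.nilpotentExtension π).radical G).map
      (QuotientGroup.mk' ((X.piExtension π).radical G)) ⊓ M : Subgroup _)) : Set _) ⊓ M ≤
    ((X.nilpotentExtension π).radical G).map
      (QuotientGroup.mk' ((X.piExtension π).radical G)) := by
  have hs := QuotientGroup.mk'_surjective ((X.piExtension π).radical G)
  refine (hG.of_surjective _ hs).centralizer_inf_le (hX.radical_quotient_eq_bot hne)
    map_radical_normal (hX.nilpotentPi_map_radical hne).2 (fun N hN hN' => ?_) hM
  have h1 := le_radical (hN.comap (QuotientGroup.mk' ((X.piExtension π).radical G)))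
    (hX.nilpotentExtension_comap hne hN')
  intro y hy
  obtain ⟨x, rfl⟩ := hs y
  exact ⟨x, h1 hy, rfl⟩

theorem IsFitting.centralizer_le (hX : X.IsFitting) (hne : X.IsNonempty) (hG : HasPiSeries π G) :
    Subgroup.centralizer ((((X.nilpotentExtension π).radical G).map
      (QuotientGroup.mk' ((X.piExtension π).radical G)) : Subgroup _) : Set _) ≤
    ((X.nilpotentExtension π).radical G).map
      (QuotientGroup.mk' ((X.piExtension π).radical G)) := by
  simpa using hX.centralizer_inf_le hne hG (M := ⊤) inferInstance

/-- The `X.piExtension π`-radical of a subgroup of a normal subgroup `M` that contains the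
`X.nilpotentExtension π`-radical of `M` lies in the `X.piExtension π`-radical of the group. -/
theorem IsFitting.radicalOf_le_of_inf_le (hX : X.IsFitting) (hne : X.IsNonempty)
    (hG : HasPiSeries π G) {M U : Subgroup G} (hM : M.Normal)
    (hTU : (X.nilpotentExtension π).radical G ⊓ M ≤ U) (hUM : U ≤ M) :
    (X.piExtension π).radicalOf U ≤ (X.piExtension π).radical G := by
  have hE := hX.piExtension (π := π) hne
  have hEne := hX.piExtension_isNonempty (π := π) hne
  set r := QuotientGroup.mk' ((X.piExtension π).radical G) with hr
  set T := (X.nilpotentExtension π).radical G with hT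
  have hTn : T.Normal := radical_normal _ _
  have hOT : (X.piExtension π).radical G ≤ T := hX.radical_piExtension_le hne
  have hrk : ∀ x, r x = 1 ↔ x ∈ (X.piExtension π).radical G := fun x => QuotientGroup.eq_one_iff x
  -- This intersection is normalized by T ∩ M ≤ U, so it lies in the radical of the normal subgroup
  -- T ∩ M.
  have hB : (X.piExtension π).radicalOf U ⊓ T ≤ (X.piExtension π).radical G := by
    have h1 : X.piExtension π ((X.piExtension π).radicalOf U ⊓ T : Subgroup G) :=
      hE.of_normalized inf_le_left (fun l hl k hk =>
        ⟨mul_mem (mul_mem hl hk.1) (Subgroup.inv_mem _ hl), hTn.conj_mem k hk.2 l⟩) (hE.radicalOf_mem hEne U)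
    refine (hE.le_radicalOf (K := T ⊓ M) ?_ ?_ h1).trans
      (hE.radicalOf_le_radical hEne (inferInstance : (T ⊓ M).Normal).isSubnormal)
    · exact fun x hx => ⟨hx.2, hUM (radicalOf_le U hx.1)⟩
    · exact fun k hk n hn => ⟨conj_mem_radicalOf (hTU hk) hn.1, hTn.conj_mem n hn.2 k⟩
  intro x hx
  have hxU : x ∈ U := radicalOf_le U hx
  -- By `hB`, commutators of x with elements of T ∩ M vanish modulo the radical, so `r x`
  -- centralizes the image of T inside that of M and the relative centralizer bound applies.
  have hxr : r x ∈ T.map r := by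
    refine hX.centralizer_inf_le hne hG (hM.map r (QuotientGroup.mk'_surjective _)) ⟨?_, ?_⟩
    · rintro _ ⟨⟨t, ht, rfl⟩, ⟨m, hm, hmt⟩⟩
      have hmT : m ∈ T := by
        have : r (t⁻¹ * m) = 1 := by rw [map_mul, map_inv, hmt, inv_mul_cancel]
        simpa using mul_mem ht (hOT ((hrk _).1 this))
      have h1 : x * m * x⁻¹ * m⁻¹ ∈ (X.piExtension π).radicalOf U ⊓ T := by
        refine ⟨?_, mul_mem (hTn.conj_mem m hmT x) (T.inv_mem hmT)⟩
        have := mul_mem hx (conj_mem_radicalOf (hTU ⟨hmT, hm⟩) (inv_mem hx))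
        simpa [mul_assoc] using this
      have h2 := (hrk _).2 (hB h1)
      rw [map_mul, map_mul, map_mul, map_inv, map_inv, mul_inv_eq_one, mul_inv_eq_iff_eq_mul] at h2
      rw [← hmt]
      exact h2.symm
    · exact ⟨x, hUM hxU, rfl⟩
  obtain ⟨t, ht, htx⟩ := hxr
  have hxT : x ∈ T := by
    have : r (t⁻¹ * x) = 1 := by rw [map_mul, map_inv, htx, inv_mul_cancel]
    simpa using mul_mem ht (hOT ((hrk _).1 this))
  exact hB ⟨hx, hxT⟩

theorem IsFitting.nilpotentExtension_comap_of_isNilpotent (hX : X.IsFitting) (hne : X.IsNonempty)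
    (hG : HasPiSeries π G) {Q : Subgroup (G ⧸ (X.piExtension π).radical G)}
    (hQ : Group.IsNilpotent Q) (hTQ : ((X.nilpotentExtension π).radical G).map
      (QuotientGroup.mk' ((X.piExtension π).radical G)) ≤ Q) :
    X.nilpotentExtension π (Q.comap (QuotientGroup.mk' ((X.piExtension π).radical G))) :=
  hX.nilpotentExtension_comap hne ⟨hQ, Subgroup.isPiGroup_of_isNilpotent
    (hX.centralizer_le hne hG) (hX.nilpotentPi_map_radical hne).2 hQ hTQ⟩

theorem IsFitting.isNilpotent_map (hX : X.IsFitting) (hne : X.IsNonempty)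
    (hG : HasPiSeries π G) {V : Subgroup G} (hV : X.nilpotentExtension π V)
    (hTV : (X.nilpotentExtension π).radical G ≤ V) :
    Group.IsNilpotent (V.map (QuotientGroup.mk' ((X.piExtension π).radical G))) :=
  (nilpotentPi_map hV (hX.radicalOf_le_of_inf_le hne hG (M := ⊤) inferInstance
    (inf_le_left.trans hTV) le_top)).1

theorem IsFitting.exists_conj_le (hX : X.IsFitting) (hne : X.IsNonempty) (hG : HasPiSeries π G)
    {V W : Subgroup G} (hV : X.nilpotentExtension π V) (hW : X.nilpotentExtension π W)
    (hTV : (X.nilpotentExtension π).radical G ≤ V)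
    (hTW : (X.nilpotentExtension π).radical G ≤ W) :
    ∃ (g : G) (Y : Subgroup G), X.nilpotentExtension π Y ∧ V ≤ Y ∧ ∀ w ∈ W, g * w * g⁻¹ ∈ Y := by
  obtain ⟨g, Q, hQ, hVQ, hWQ⟩ := Subgroup.exists_conj_le_isNilpotent map_radical_normal
    (hX.centralizer_le hne hG) (hX.isNilpotent_map hne hG hV hTV)
    (hX.isNilpotent_map hne hG hW hTW) (Subgroup.map_mono hTV) (Subgroup.map_mono hTW)
  obtain ⟨g, rfl⟩ := QuotientGroup.mk'_surjective _ g
  refine ⟨g, _, hX.nilpotentExtension_comap_of_isNilpotent hne hG hQ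
    ((Subgroup.map_mono hTV).trans hVQ), Subgroup.map_le_iff_le_comap.1 hVQ, fun w hw => ?_⟩
  exact hWQ _ ⟨w, hw, rfl⟩

theorem IsFitting.exists_le_of_inf_le (hX : X.IsFitting) (hne : X.IsNonempty)
    (hG : HasPiSeries π G) {M U : Subgroup G} (hM : M.Normal) (hU : X.nilpotentExtension π U)
    (hTU : (X.nilpotentExtension π).radical G ⊓ M ≤ U) (hUM : U ≤ M) :
    ∃ Y : Subgroup G, X.nilpotentExtension π Y ∧ U ≤ Y ∧
      (X.nilpotentExtension π).radical G ≤ Y := by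
  set r := QuotientGroup.mk' ((X.piExtension π).radical G) with hr
  have hUn := (nilpotentPi_map hU (hX.radicalOf_le_of_inf_le hne hG hM hTU hUM)).1
  have hTU' : ((X.nilpotentExtension π).radical G).map r ⊓ M.map r ≤ U.map r := by
    rintro _ ⟨⟨t, ht, rfl⟩, ⟨m, hm, hmt⟩⟩
    have hmT : m ∈ (X.nilpotentExtension π).radical G := by
      have : r (t⁻¹ * m) = 1 := by rw [map_mul, map_inv, hmt, inv_mul_cancel]
      simpa using mul_mem ht (hX.radical_piExtension_le hne ((QuotientGroup.eq_one_iff _).1 this))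
    exact ⟨m, hTU ⟨hmT, hm⟩, hmt⟩
  obtain ⟨Q, hQ, hUQ, hTQ⟩ := Subgroup.exists_isNilpotent_of_inf_le map_radical_normal
    (hX.nilpotentPi_map_radical hne).1 (hX.centralizer_le hne hG)
    (hM.map r (QuotientGroup.mk'_surjective _)) hUn hTU' (Subgroup.map_mono hUM)
  exact ⟨_, hX.nilpotentExtension_comap_of_isNilpotent hne hG hQ hTQ,
    Subgroup.map_le_iff_le_comap.1 hUQ, Subgroup.map_le_iff_le_comap.1 hTQ⟩

/-! ### Injectors as maximal subgroups containing the radical. -/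

theorem isMaximalSubgroup_map {F : GroupClass.{u}} (hF : F.IsFitting) {A B : Type u} [Group A]
    [Group B] (e : A ≃* B) {V : Subgroup A} (hV : F.IsMaximalSubgroup V) :
    F.IsMaximalSubgroup (V.map e.toMonoidHom) := by
  refine ⟨(hF.map_iff _ _ e.injective).2 hV.1, fun U hVU hU => ?_⟩
  have h1 : U.map e.symm.toMonoidHom = V := by
    refine hV.2 _ (fun v hv => ⟨e v, hVU ⟨v, hv, rfl⟩, by simp⟩)
      ((hF.map_iff _ _ e.symm.injective).2 hU)
  rw [← h1]
  ext x
  simp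

/-- A larger `U` in `M` would lie with the radical in some `Y` of the class. A conjugate of `Y` lies
in `V`, so a conjugate of `U` lies in V ∩ M, and comparing orders forces equality. -/
theorem IsFitting.isMaximalSubgroup_subgroupOf (hX : X.IsFitting) (hne : X.IsNonempty)
    (hG : HasPiSeries π G) {V M : Subgroup G} (hV : (X.nilpotentExtension π).IsMaximalSubgroup V)
    (hTV : (X.nilpotentExtension π).radical G ≤ V) (hM : M.Normal) :
    (X.nilpotentExtension π).IsMaximalSubgroup (V.subgroupOf M) := by
  have hF := hX.nilpotentExtension (π := π) hne
  refine ⟨?_, fun U hVU hU => ?_⟩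
  · rw [← Subgroup.inf_subgroupOf_right, hF.subgroupOf_iff inf_le_right]
    refine hF.of_normalized inf_le_left (fun l hl k hk => ?_) hV.1
    exact ⟨mul_mem (mul_mem hl hk.1) (Subgroup.inv_mem _ hl), hM.conj_mem k hk.2 l⟩
  · have hU' : X.nilpotentExtension π (U.map M.subtype) :=
      (hF.map_iff _ _ M.subtype_injective).2 hU
    obtain ⟨Y, hY, hUY, hTY⟩ := hX.exists_le_of_inf_le hne hG hM hU'
      (fun x hx => ⟨⟨x, hx.2⟩, hVU (hTV hx.1), rfl⟩) (Subgroup.map_subtype_le U)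
    obtain ⟨g, Z, hZ, hVZ, hYZ⟩ := hX.exists_conj_le hne hG hV.1 hY hTV hTY
    rw [hV.2 Z hVZ hZ] at hYZ
    symm
    refine Subgroup.eq_of_le_of_card_ge hVU ?_
    refine Nat.card_le_card_of_injective
      (fun u : U => (⟨⟨g * u * g⁻¹, hM.conj_mem _ u.1.2 g⟩, hYZ _ (hUY ⟨u, u.2, rfl⟩)⟩ :
        V.subgroupOf M)) fun a b h => ?_
    have := congrArg (fun z : V.subgroupOf M => ((z : M) : G)) h
    exact Subtype.ext (Subtype.ext (by simpa using this))

theorem IsFitting.isInjector_iff (hX : X.IsFitting) (hne : X.IsNonempty) (hG : HasPiSeries π G)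
    {V : Subgroup G} : (X.nilpotentExtension π).IsInjector V ↔
      (X.nilpotentExtension π).IsMaximalSubgroup V ∧ (X.nilpotentExtension π).radical G ≤ V := by
  have hF := hX.nilpotentExtension (π := π) hne
  have hFne := hX.nilpotentExtension_isNonempty (π := π) hne
  constructor
  · intro h
    refine ⟨?_, ?_⟩
    · have h1 := isMaximalSubgroup_map hF Subgroup.topEquiv (h ⊤ Subgroup.IsSubnormal.top)
      have h2 : (V.subgroupOf ⊤).map (Subgroup.topEquiv (G := G)).toMonoidHom = V := by
        ext x
        constructor
        · rintro ⟨y, hy, rfl⟩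
          exact hy
        · exact fun hx => ⟨⟨x, Subgroup.mem_top x⟩, hx, rfl⟩
      rwa [h2] at h1
    · have h1 := (h _ ((X.nilpotentExtension π).radical_normal G).isSubnormal).2 ⊤ le_top
        (hF.top_iff.2 (hF.radical_mem hFne G))
      exact Subgroup.subgroupOf_eq_top.1 h1.symm
  · rintro ⟨hV, hTV⟩ K hK
    induction hK with
    | top =>
      have h1 := isMaximalSubgroup_map hF (Subgroup.topEquiv (G := G)).symm hV
      have h2 : V.map (Subgroup.topEquiv (G := G)).symm.toMonoidHom = V.subgroupOf ⊤ := by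
        ext x
        constructor
        · rintro ⟨y, hy, rfl⟩
          exact hy
        · exact fun hx => ⟨x, hx, rfl⟩
      rwa [h2] at h1
    | step H K h_le hSubn hN ih =>
      -- The radical of the subnormal `K` lies in that of `G`, hence in `V`; so the normal-subgroup
      -- case can be repeated inside `K`.
      have hTK : (X.nilpotentExtension π).radical K ≤ V.subgroupOf K := fun x hx =>
        hTV (hF.radicalOf_le_radical hFne hSubn ⟨x, hx, rfl⟩)
      have h1 := isMaximalSubgroup_map hF (Subgroup.subgroupOfEquivOfLe h_le)
        (hX.isMaximalSubgroup_subgroupOf hne (hG.of_injective K.subtype K.subtype_injective) ih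
          hTK hN)
      have h2 : ((V.subgroupOf K).subgroupOf (H.subgroupOf K)).map
          (Subgroup.subgroupOfEquivOfLe h_le).toMonoidHom = V.subgroupOf H := by
        ext x
        constructor
        · rintro ⟨y, hy, rfl⟩
          exact hy
        · exact fun hx => ⟨⟨⟨x, h_le x.2⟩, x.2⟩, hx, rfl⟩
      rwa [h2] at h1

theorem IsFitting.exists_isInjector_iff_conj (hX : X.IsFitting) (hne : X.IsNonempty)
    (hG : HasPiSeries π G) : ∃ V : Subgroup G, ∀ W : Subgroup G,
      (X.nilpotentExtension π).IsInjector W ↔ ∃ g : G, W = V.map (MulAut.conj g).toMonoidHom := by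
  have hF := hX.nilpotentExtension (π := π) hne
  have hFne := hX.nilpotentExtension_isNonempty (π := π) hne
  have hTn : ((X.nilpotentExtension π).radical G).Normal := radical_normal _ _
  -- Any member of the class maximal over the radical will serve as the representative.
  obtain ⟨V, hTV, hV⟩ := (Set.toFinite {U : Subgroup G | X.nilpotentExtension π U}).exists_le_maximal
    (hF.radical_mem hFne G)
  have hVmax : (X.nilpotentExtension π).IsMaximalSubgroup V :=
    ⟨hV.prop, fun U hVU hU => (hV.eq_of_le hU hVU).symm⟩
  have hconj : ∀ (g : G) {U : Subgroup G}, (X.nilpotentExtension π).radical G ≤ U →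
      (X.nilpotentExtension π).radical G ≤ U.map (MulAut.conj g).toMonoidHom := by
    intro g U hTU x hx
    exact ⟨g⁻¹ * x * g, hTU (by simpa using hTn.conj_mem x hx g⁻¹), by simp [mul_assoc]⟩
  refine ⟨V, fun W => ?_⟩
  rw [hX.isInjector_iff hne hG]
  constructor
  · rintro ⟨hW, hTW⟩
    obtain ⟨g, Y, hY, hWY, hVY⟩ := hX.exists_conj_le hne hG hW.1 hVmax.1 hTW hTV
    refine ⟨g, ?_⟩
    rw [hW.2 Y hWY hY] at hVY
    exact (isMaximalSubgroup_map hF (MulAut.conj g) hVmax).2 W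
      (by rintro _ ⟨v, hv, rfl⟩; exact hVY v hv) hW.1
  · rintro ⟨g, rfl⟩
    exact ⟨isMaximalSubgroup_map hF (MulAut.conj g) hVmax, hconj g hTV⟩

end GroupClass

theorem corollary1p5p1 (π : Set Nat.Primes) (X : GroupClass.{u}) (hX : X.IsFitting)
    (hne : X.IsNonempty) (G : Type u) [Group G] (hG : IsPiSoluble π G) :
    ∃ V : Subgroup G, ∀ W : Subgroup G,
      (X.prod (piNilpotent π)).IsInjector W ↔
        ∃ g : G, W = V.map (MulAut.conj g).toMonoidHom := by
  have := hG.1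
  rw [hX.prod_piNilpotent_eq hne π]
  exact hX.exists_isInjector_iff_conj hne (HasPiSeries.of_isPiSoluble hG)
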